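/- **Setting.** Let $d\in\{2,3\}$ and let $k\ge 0$ be an integer. For a nondegenerate closed simplex $K\subset\mathbb R^d$ let $h_K$ be its diameter, $n_K$ its unit outward normal, and $\mathcal F_{\partial K}$ the set of its $d+1$ faces. $\mathbb P_l(K)$ and $\mathbb P_l(F)$ denote the restrictions to $K$ and to $F$ of the polynomials in $d$ variables of total degree at most $l$. $(\cdot,\cdot)_K$ and $(\cdot,\cdot)_{\partial K}$ are the $L^2$ inner products, with norms $\|\cdot\|_K$ and $\|\cdot\|_{\partial K}$ (the latter with respect to surface measure), and $\partial_n v$, $\partial_{nn}v$ are the normal derivative and the normal-normal second derivative on $\partial K$. The local space is $\hat V_K^k=\mathbb P_{k+2}(K)\times\prod_{F\in\mathcal F_{\partial K}}\mathbb P_k(F)$, with elements $\hat v_K=(v_K,\gamma_{\partial K})$, and $$|\hat v_K|^2_{\hat V_K^k}=\|\nabla^2 v_K\|_K^2+h_K^{-1}\|\gamma_{\partial K}-\partial_n v_K\|_{\partial K}^2 .$$ The reconstruction $R_K\hat v_K\in\mathbb P_{k+2}(K)$ is defined by $$(\nabla^2R_K\hat v_K,\nabla^2w)_K=(\nabla^2v_K,\nabla^2w)_K-(\partial_nv_K-\gamma_{\partial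 K},\partial_{nn}w)_{\partial K}$$ for all $w\in\mathbb P_{k+2}(K)$ with $(w,\xi)_K=0$ for all $\xi\in\mathbb P_1(K)$, together with $(R_K\hat v_K,\xi)_K=(v_K,\xi)_K$ for all $\xi\in\mathbb P_1(K)$. With $\Pi^k_{\partial K}$ the $L^2$-orthogonal projection onto $\prod_{F\in\mathcal F_{\partial K}}\mathbb P_k(F)$ and $\hat w_K=(w_K,\chi_{\partial K})$, set $$S_{\partial K}(\hat v_K,\hat w_K)=h_K^{-1}\big(\Pi^k_{\partial K}(\gamma_{\partial K}-\partial_nv_K),\,\chi_{\partial K}-\partial_nw_K\big)_{\partial K},$$ $$a_K(\hat v_K,\hat w_K)=(\nabla^2R_K\hat v_K,\nabla^2R_K\hat w_K)_K+S_{\partial K}(\hat v_K,\hat w_K).$$ Let $\mathcal T$ be a finite conforming simplicial mesh in $\mathbb R^d$ (two distinct cells intersect exactly in the convex hull of their common vertices), and let $\Omega$ be the interior of the union of its cells. (Every bounded Lipschitz domain covered exactly by $\mathcal T$ is of this form.) The mesh is shape-regular with parameter $\sigma$ if every cell $K$ contains a ball of some radius $r>0$ with $h_K\le 2\sigma r$.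 Let $\mathcal F$ be the set of mesh faces; each $F\in\mathcal F$ carries a fixed unit normal $n_F$, which is the outward normal on $F$ of one of the cells having $F$ as a face. Let $V_{\mathcal T,0}^{k+2}$ be the space of continuous functions on $\overline\Omega$ that are polynomials of degree at most $k+2$ on each cell and vanish on $\partial\Omega$. Let $V^k_{\mathcal F}=\prod_{F\in\mathcal F}\mathbb P_k(F)$, let $V^k_{\mathcal F,0}$ be its subspace of families that vanish on every face contained in $\partial\Omega$, and set $$\hat V_h^{k,(\mathrm I)}=V_{\mathcal T,0}^{k+2}\times V^k_{\mathcal F,0},\qquad \hat V_h^{k,(\mathrm{II})}=V_{\mathcal T,0}^{k+2}\times V^k_{\mathcal F}$$ (clamped and simply supported boundary conditions). For $\hat v_h=(v_{\mathcal T},\gamma_{\mathcal F})$ put $\hat v_K=(v_{\mathcal T}|_K,\gamma_{\partial K})$ with $\gamma_{\partial K}|_F=(n_F\cdot n_K)\gamma_F$, and $a_h(\hat v_h,\hat w_h)=\sum_{K\in\mathcal T}a_K(\hat v_K,\hat w_K)$, $\|\hat v_h\|^2_{\hat V_h^k}=\sum_{K\in\mathcal T}|\hat v_K|^2_{\hat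 V_K^k}$. **Lemma (local stability and boundedness).** For all $d\in\{2,3\}$, $k\ge0$ and $\sigma$ there is a real number $\alpha>0$, depending only on $d$, $k$ and $\sigma$, such that for every mesh $\mathcal T$ as above that is shape-regular with parameter $\sigma$: 1. For all $K\in\mathcal T$ and all $\hat v_K\in\hat V_K^k$, the reconstruction $R_K\hat v_K$ is uniquely defined and $$\alpha|\hat v_K|^2_{\hat V_K^k}\le\|\nabla^2R_K\hat v_K\|_K^2+S_{\partial K}(\hat v_K,\hat v_K)\le\alpha^{-1}|\hat v_K|^2_{\hat V_K^k}.$$ 2. Let $\hat V$ be either of the spaces $\hat V_h^{k,(\mathrm I)}$, $\hat V_h^{k,(\mathrm{II})}$. If $\hat v_h\in\hat V$ satisfies $\|\hat v_h\|_{\hat V_h^k}=0$, then $\hat v_h=0$. The form $a_h$ is coercive: $a_h(\hat v_h,\hat v_h)\ge\alpha\|\hat v_h\|^2_{\hat V_h^k}$ for all $\hat v_h\in\hat V$. The discrete problem is well-posed: for every linear functional $\ell$ on $V_{\mathcal T,0}^{k+2}$ there is exactly one $\hat u_h\in\hat V$ with $a_h(\hat u_h,\hat w_h)=\ell(w_{\mathcal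 T})$ for all $\hat w_h=(w_{\mathcal T},\chi_{\mathcal F})\in\hat V$; and if $C\ge0$ is such that $|\ell(w_{\mathcal T})|\le C\|\hat w_h\|_{\hat V_h^k}$ for all $\hat w_h\in\hat V$, then $\|\hat u_h\|_{\hat V_h^k}\le\alpha^{-1}C$. -/

import Mathlib

open MeasureTheory

noncomputable section

namespace C0HHO

/-- Points of the Euclidean space `ℝ^d`. -/
abbrev Pt (d : ℕ) := EuclideanSpace ℝ (Fin d)

/-- A (nondegenerate) `d`-simplex in `ℝ^d`, given by its `d + 1` vertices. -/
abbrev Cell (d : ℕ) := Affine.Simplex ℝ (Pt d) d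

/-- Polynomials in `d` real variables. -/
abbrev Poly (d : ℕ) := MvPolynomial (Fin d) ℝ

/-! ### Polynomials and their derivatives -/

/-- The space `ℙ_l` of polynomials of total degree at most `l`. A polynomial is determined by its
values on a cell (which has nonempty interior), so this is also `ℙ_l(K)`. -/
abbrev polySpace (d l : ℕ) : Submodule ℝ (Poly d) := MvPolynomial.restrictTotalDegree (Fin d) ℝ l

/-- The value `p(x)`. -/
def polyVal {d : ℕ} (p : Poly d) (x : Pt d) : ℝ := MvPolynomial.eval (fun i => x i) p

/-- The directional derivative `n · ∇p(x)`. -/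
def dn {d : ℕ} (n : Pt d) (p : Poly d) (x : Pt d) : ℝ :=
  ∑ i, n i * polyVal (MvPolynomial.pderiv i p) x

/-- The Hessian `∇²p(x)`. -/
def hess {d : ℕ} (p : Poly d) (x : Pt d) : Matrix (Fin d) (Fin d) ℝ :=
  Matrix.of fun i j => polyVal (MvPolynomial.pderiv i (MvPolynomial.pderiv j p)) x

/-- The second directional derivative `n · ∇²p(x) n`. -/
def dnn {d : ℕ} (n : Pt d) (p : Poly d) (x : Pt d) : ℝ :=
  ∑ i, ∑ j, n i * hess p x i j * n j

/-! ### Geometry of a cell -/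

/-- The closed simplex `K` as a set. -/
def body {d : ℕ} (K : Cell d) : Set (Pt d) := convexHull ℝ (Set.range K.points)

/-- The diameter `h_K`. -/
def diamCell {d : ℕ} (K : Cell d) : ℝ := Metric.diam (body K)

/-- The closed face of `K` opposite to the vertex number `i`. -/
def facet {d : ℕ} (K : Cell d) (i : Fin (d + 1)) : Set (Pt d) :=
  convexHull ℝ (K.points '' {i}ᶜ)

/-- The unit outward normal `n_K` on the face opposite to the vertex number `i`: it points from
this vertex to its orthogonal projection onto the hyperplane that carries the face. -/
def normal {d : ℕ} [NeZero d] (K : Cell d) (i : Fin (d + 1)) : Pt d :=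
  (K.height i)⁻¹ • (K.altitudeFoot i - K.points i)

/-! ### Polynomials on faces, inner products -/

/-- The space `ℙ_l(F)`: restrictions to `F` of polynomials of degree at most `l`. -/
def facePoly {d : ℕ} (l : ℕ) (F : Set (Pt d)) : Submodule ℝ (F → ℝ) where
  carrier := {g | ∃ p ∈ polySpace d l, ∀ x : F, g x = polyVal p x}
  zero_mem' := ⟨0, Submodule.zero_mem _, fun x => by simp [polyVal]⟩
  add_mem' := by
    rintro g g' ⟨p, hp, hg⟩ ⟨p', hp', hg'⟩
    exact ⟨p + p', Submodule.add_mem _ hp hp', fun x => by simp [polyVal, hg, hg']⟩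
  smul_mem' := by
    rintro c g ⟨p, hp, hg⟩
    exact ⟨c • p, Submodule.smul_mem _ c hp, fun x => by
      simp [polyVal, hg, MvPolynomial.smul_eval]⟩

/-- The `L²(F)` inner product with respect to the `(d-1)`-dimensional surface measure. -/
def faceInner {d : ℕ} (F : Set (Pt d)) (f g : F → ℝ) : ℝ :=
  ∫ x : F, f x * g x ∂(Measure.comap (Subtype.val : F → Pt d) μHE[d - 1])

/-- The `L²(K)` inner product of two polynomials. -/
def cellInner {d : ℕ} (K : Cell d) (p q : Poly d) : ℝ :=
  ∫ x in body K, polyVal p x * polyVal q x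

/-- `(∇²p, ∇²q)_K`. -/
def hessInner {d : ℕ} (K : Cell d) (p q : Poly d) : ℝ :=
  ∫ x in body K, ∑ i, ∑ j, hess p x i j * hess q x i j

/-- Functions on `∂K`, given face by face. -/
abbrev BdFun {d : ℕ} (K : Cell d) := (i : Fin (d + 1)) → facet K i → ℝ

/-- The inner product `(φ, ψ)_{∂K}`. -/
def bdInner {d : ℕ} (K : Cell d) (φ ψ : BdFun K) : ℝ :=
  ∑ i, faceInner (facet K i) (φ i) (ψ i)

/-- The normal derivative `∂_n p` on `∂K`. -/
def dnBd {d : ℕ} [NeZero d] (K : Cell d) (p : Poly d) : BdFun K :=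
  fun i x => dn (normal K i) p x

/-- The normal-normal second derivative `∂_{nn} p` on `∂K`. -/
def dnnBd {d : ℕ} [NeZero d] (K : Cell d) (p : Poly d) : BdFun K :=
  fun i x => dnn (normal K i) p x

/-- `q` is the `L²(F)`-orthogonal projection of `f` onto `ℙ_k(F)`. -/
def IsFaceProj {d : ℕ} (k : ℕ) (F : Set (Pt d)) (f q : F → ℝ) : Prop :=
  q ∈ facePoly k F ∧ ∀ r ∈ facePoly k F, faceInner F (f - q) r = 0

/-- The `L²`-orthogonal projection `Π^k_{∂K}` onto `ℙ_k(F_{∂K})`. -/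
def bdProj {d : ℕ} (k : ℕ) (K : Cell d) (φ : BdFun K) : BdFun K :=
  fun i => Classical.epsilon (IsFaceProj k (facet K i) (φ i))

/-! ### Local unknowns, reconstruction, stabilization -/

/-- Pairs `(v_K, γ_{∂K})`. -/
abbrev LocalPair {d : ℕ} (K : Cell d) := Poly d × BdFun K

/-- The local space `ℙ_{k+2}(K) × ℙ_k(F_{∂K})`. -/
def localSpace {d : ℕ} (k : ℕ) (K : Cell d) : Submodule ℝ (LocalPair K) :=
  (polySpace d (k + 2)).prod (Submodule.pi Set.univ fun i => facePoly k (facet K i))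

/-- `r` solves the problem that defines the reconstruction `R_K(v)`. -/
def IsReconstruction {d : ℕ} [NeZero d] (k : ℕ) (K : Cell d) (v : LocalPair K) (r : Poly d) :
    Prop :=
  r ∈ polySpace d (k + 2) ∧
  (∀ w ∈ polySpace d (k + 2), (∀ ξ ∈ polySpace d 1, cellInner K w ξ = 0) →
    hessInner K r w = hessInner K v.1 w - bdInner K (dnBd K v.1 - v.2) (dnnBd K w)) ∧
  ∀ ξ ∈ polySpace d 1, cellInner K r ξ = cellInner K v.1 ξ

/-- The reconstruction operator `R_K`. -/
def recon {d : ℕ} [NeZero d] (k : ℕ) (K : Cell d) (v : LocalPair K) : Poly d :=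
  Classical.epsilon (IsReconstruction k K v)

/-- The stabilization bilinear form `S_{∂K}`. -/
def stab {d : ℕ} [NeZero d] (k : ℕ) (K : Cell d) (v w : LocalPair K) : ℝ :=
  (diamCell K)⁻¹ * bdInner K (bdProj k K (v.2 - dnBd K v.1)) (w.2 - dnBd K w.1)

/-- The local bilinear form `a_K`. -/
def localForm {d : ℕ} [NeZero d] (k : ℕ) (K : Cell d) (v w : LocalPair K) : ℝ :=
  hessInner K (recon k K v) (recon k K w) + stab k K v w

/-- The square of the local energy seminorm,
`‖∇²v_K‖_K² + h_K⁻¹ ‖γ_{∂K} - ∂_n v_K‖_{∂K}²`. -/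
def localEnergy {d : ℕ} [NeZero d] (K : Cell d) (v : LocalPair K) : ℝ :=
  hessInner K v.1 v.1 + (diamCell K)⁻¹ * bdInner K (v.2 - dnBd K v.1) (v.2 - dnBd K v.1)

/-! ### Meshes -/

/-- A finite conforming simplicial mesh in `ℝ^d` together with an orientation of its faces: two
distinct cells have distinct vertex sets and meet exactly in the simplex spanned by their common
vertices, and every face `F` carries a unit normal `n_F`, which is the outward normal of one of the
cells that have `F` as a face (the only such cell if `F` lies on the boundary). -/
structure Mesh (d : ℕ) [NeZero d] where
  cells : Finset (Cell d)
  vertices_ne : ∀ K ∈ cells, ∀ L ∈ cells, K ≠ L → Set.range K.points ≠ Set.range L.points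
  conforming : ∀ K ∈ cells, ∀ L ∈ cells, K ≠ L →
    body K ∩ body L = convexHull ℝ (Set.range K.points ∩ Set.range L.points)
  faceNormal : Set (Pt d) → Pt d
  faceNormal_spec : ∀ K ∈ cells, ∀ i, ∃ L ∈ cells, ∃ j,
    facet L j = facet K i ∧ faceNormal (facet K i) = normal L j

namespace Mesh

/-- Shape regularity with parameter `σ`: every cell contains a ball whose diameter `2 r` satisfies
`h_K ≤ σ (2 r)`. -/
def ShapeRegular {d : ℕ} [NeZero d] (M : Mesh d) (σ : ℝ) : Prop :=
  ∀ K ∈ M.cells, ∃ x r, 0 < r ∧ Metric.closedBall x r ⊆ body K ∧ diamCell K ≤ σ * (2 * r)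

/-- The open set `Ω` that the mesh covers. -/
def domain {d : ℕ} [NeZero d] (M : Mesh d) : Set (Pt d) := interior (⋃ K ∈ M.cells, body K)

/-- The set of all mesh faces. -/
def faces {d : ℕ} [NeZero d] (M : Mesh d) : Set (Set (Pt d)) :=
  {F | ∃ K ∈ M.cells, ∃ i, F = facet K i}

/-- Families `(v_K)_K` of polynomials. -/
abbrev CellFun {d : ℕ} [NeZero d] (M : Mesh d) := M.cells → Poly d

/-- Families `(γ_F)_F` of functions on the mesh faces. -/
abbrev FaceFun {d : ℕ} [NeZero d] (M : Mesh d) := (F : M.faces) → F.1 → ℝ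

/-- The continuous piecewise polynomials of degree at most `l` that vanish on `∂Ω`, that is,
`ℙ_l^g(T) ∩ H¹₀(Ω)`. -/
def cellSpace0 {d : ℕ} [NeZero d] (M : Mesh d) (l : ℕ) : Submodule ℝ M.CellFun where
  carrier := {v | (∀ K, v K ∈ polySpace d l) ∧
    (∀ K L : M.cells, ∀ x ∈ body K.1 ∩ body L.1, polyVal (v K) x = polyVal (v L) x) ∧
    ∀ K : M.cells, ∀ x ∈ body K.1 ∩ frontier M.domain, polyVal (v K) x = 0}
  zero_mem' := ⟨fun _ => Submodule.zero_mem _, fun _ _ _ _ => rfl, fun _ _ _ => by simp [polyVal]⟩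
  add_mem' := by
    rintro v w ⟨h1, h2, h3⟩ ⟨h1', h2', h3'⟩
    refine ⟨fun K => Submodule.add_mem _ (h1 K) (h1' K), fun K L x hx => ?_, fun K x hx => ?_⟩
    · have := h2 K L x hx
      have := h2' K L x hx
      simp_all [polyVal]
    · have := h3 K x hx
      have := h3' K x hx
      simp_all [polyVal]
  smul_mem' := by
    rintro c v ⟨h1, h2, h3⟩
    refine ⟨fun K => Submodule.smul_mem _ c (h1 K), fun K L x hx => ?_, fun K x hx => ?_⟩
    · have := h2 K L x hx
      simp_all [polyVal, MvPolynomial.smul_eval]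
    · have := h3 K x hx
      simp_all [polyVal, MvPolynomial.smul_eval]

/-- The space `ℙ_k(F)` of face unknowns: `γ_F ∈ ℙ_k(F)` for every mesh face. -/
def faceSpace {d : ℕ} [NeZero d] (M : Mesh d) (k : ℕ) : Submodule ℝ M.FaceFun :=
  Submodule.pi Set.univ fun F => facePoly k F.1

/-- The face unknowns that vanish on the boundary faces. -/
def faceSpace0 {d : ℕ} [NeZero d] (M : Mesh d) (k : ℕ) : Submodule ℝ M.FaceFun :=
  M.faceSpace k ⊓
    Submodule.pi {F : M.faces | (F : Set (Pt d)) ⊆ frontier M.domain} fun _ => ⊥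

/-- The local component `(v_K, γ_{∂K})` of `(v_T, γ_F)`, where `γ_{∂K}|_F = (n_F · n_K) γ_F`. -/
def localize {d : ℕ} [NeZero d] (M : Mesh d) (v : M.CellFun × M.FaceFun) (K : M.cells) :
    LocalPair K.1 :=
  (v.1 K, fun i x => inner ℝ (M.faceNormal (facet K.1 i)) (normal K.1 i) *
    v.2 ⟨facet K.1 i, K.1, K.2, i, rfl⟩ x)

/-- The global bilinear form `a_h`. -/
def form {d : ℕ} [NeZero d] (M : Mesh d) (k : ℕ) (v w : M.CellFun × M.FaceFun) : ℝ :=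
  ∑ K : M.cells, localForm k K.1 (M.localize v K) (M.localize w K)

/-- The square of the global energy norm. -/
def energy {d : ℕ} [NeZero d] (M : Mesh d) (v : M.CellFun × M.FaceFun) : ℝ :=
  ∑ K : M.cells, localEnergy K.1 (M.localize v K)

/-- The global energy norm. -/
def energyNorm {d : ℕ} [NeZero d] (M : Mesh d) (v : M.CellFun × M.FaceFun) : ℝ :=
  √(M.energy v)

/-- Global HHO unknowns: cell unknowns of degree `k + 2` vanishing on `∂Ω`, and face unknowns in
`W` (`W = faceSpace0` for clamped, `W = faceSpace` for simply supported boundary conditions). -/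
abbrev HHOSpace {d : ℕ} [NeZero d] (M : Mesh d) (k : ℕ) (W : Submodule ℝ M.FaceFun) :=
  M.cellSpace0 (k + 2) × W

/-- The underlying families of a global HHO unknown. -/
def toFun {d : ℕ} [NeZero d] (M : Mesh d) {k : ℕ} {W : Submodule ℝ M.FaceFun}
    (v : M.HHOSpace k W) : M.CellFun × M.FaceFun := (v.1, v.2)

/-- `u` solves the discrete problem `a_h(u, w) = ℓ(w_T)` for all `w`. -/
def IsDiscreteSolution {d : ℕ} [NeZero d] (M : Mesh d) (k : ℕ) (W : Submodule ℝ M.FaceFun)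
    (ℓ : M.cellSpace0 (k + 2) →ₗ[ℝ] ℝ) (u : M.HHOSpace k W) : Prop :=
  ∀ w : M.HHOSpace k W, M.form k (M.toFun u) (M.toFun w) = ℓ w.1

end Mesh

end C0HHO

end

/-!
The local estimate rests on one fact: the point values of polynomials of bounded degree near a ball
are controlled by their `L²` norm on the ball. On the unit ball this is finite-dimensional linear
algebra, and translation and dilation give the scaling in the radius (`exists_polyVal_sq_le`). A
shape-regular cell contains a ball of radius comparable to its diameter, so that no compactness
argument over the shapes of simplices is needed. Together with the bound `C h^(d-1)` for the surface
measure of a facet, this yields the discrete trace inequality for `∂_{nn}` (`exists_dnn_trace_le`)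
and, with the mean value theorem, the approximation of `∂_n v` by constants on the faces
(`exists_dn_approx_le`). The reconstruction error `R_K v̂ - v` is orthogonal to `ℙ_1`, hence may be
used as a test function; since `∂_{nn}` of it is a polynomial of degree `k` on each face, its energy
is bounded by the *projected* jump (`hessForm_recon_sub_le`). The part of the jump that the
projection removes comes from `∂_n v` alone and is bounded by the Hessian of `v`. This proves
`exists_local_stability`.

If the global energy vanishes, then `v` is affine on each cell, and the values and the normal
derivatives match across the faces, so that cells with a common facet carry the same affine function
(`eq_of_shared_facet`). Almost every line avoids the intersections of two facets of a cell. Following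
such a line through a cell in both directions to the last points with the same affine function,
one reaches `∂Ω`, where this function vanishes (`exists_zero_on_ray`); being affine on the line, it
vanishes in between (`cellFun_eq_zero`). Well-posedness is then Lax-Milgram in finite dimension.
-/

noncomputable section

namespace C0HHO

/-! ### Polynomials -/

section Polynomials

variable {d : ℕ}

@[simp] lemma polyVal_zero (x : Pt d) : polyVal 0 x = 0 := by simp [polyVal]

@[simp] lemma polyVal_C (c : ℝ) (x : Pt d) : polyVal (MvPolynomial.C c) x = c := by simp [polyVal]

@[simp] lemma polyVal_X (i : Fin d) (x : Pt d) : polyVal (MvPolynomial.X i) x = x i := by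
  simp [polyVal]

@[simp] lemma polyVal_add (p q : Poly d) (x : Pt d) :
    polyVal (p + q) x = polyVal p x + polyVal q x := by simp [polyVal]

@[simp] lemma polyVal_sub (p q : Poly d) (x : Pt d) :
    polyVal (p - q) x = polyVal p x - polyVal q x := by simp [polyVal]

@[simp] lemma polyVal_mul (p q : Poly d) (x : Pt d) :
    polyVal (p * q) x = polyVal p x * polyVal q x := by simp [polyVal]

@[simp] lemma polyVal_smul (c : ℝ) (p : Poly d) (x : Pt d) :
    polyVal (c • p) x = c * polyVal p x := by simp [polyVal, MvPolynomial.smul_eval]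

@[simp] lemma polyVal_sum {ι : Type*} (s : Finset ι) (p : ι → Poly d) (x : Pt d) :
    polyVal (∑ i ∈ s, p i) x = ∑ i ∈ s, polyVal (p i) x := by simp [polyVal]

lemma continuous_polyVal (p : Poly d) : Continuous (polyVal p) := by
  unfold polyVal
  have : Continuous fun x : Pt d => fun i => x i := by fun_prop
  exact (MvPolynomial.continuous_eval p).comp this

/-- The polynomial `n · ∇p`. -/
def dnPoly (n : Pt d) (p : Poly d) : Poly d := ∑ i, n i • MvPolynomial.pderiv i p

lemma polyVal_dnPoly (n : Pt d) (p : Poly d) (x : Pt d) : polyVal (dnPoly n p) x = dn n p x := by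
  simp [dnPoly, dn]

lemma polyVal_dnPoly_dnPoly (n : Pt d) (p : Poly d) (x : Pt d) :
    polyVal (dnPoly n (dnPoly n p)) x = dnn n p x := by
  simp only [dnPoly, dnn, hess, map_sum, Derivation.map_smul, polyVal_sum, polyVal_smul,
    Finset.mul_sum, Matrix.of_apply]
  exact Finset.sum_congr rfl fun i _ => Finset.sum_congr rfl fun j _ => by ring

lemma dn_add (n : Pt d) (p q : Poly d) (x : Pt d) : dn n (p + q) x = dn n p x + dn n q x := by
  simp [dn, mul_add, Finset.sum_add_distrib]

lemma dn_sub (n : Pt d) (p q : Poly d) (x : Pt d) : dn n (p - q) x = dn n p x - dn n q x := by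
  simp [dn, mul_sub, Finset.sum_sub_distrib]

lemma dn_smul (n : Pt d) (c : ℝ) (p : Poly d) (x : Pt d) : dn n (c • p) x = c * dn n p x := by
  simp [dn, Finset.mul_sum, mul_left_comm]

lemma dn_smul_left (c : ℝ) (n : Pt d) (p : Poly d) (x : Pt d) :
    dn (c • n) p x = c * dn n p x := by
  simp [dn, Finset.mul_sum, mul_assoc]

lemma dn_neg_left (n : Pt d) (p : Poly d) (x : Pt d) : dn (-n) p x = -dn n p x := by
  simp [dn]

lemma hess_add (p q : Poly d) (x : Pt d) : hess (p + q) x = hess p x + hess q x := by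
  ext; simp [hess]

lemma hess_smul (c : ℝ) (p : Poly d) (x : Pt d) : hess (c • p) x = c • hess p x := by
  ext; simp [hess]

lemma pderiv_mem_polySpace {l : ℕ} {p : Poly d} (hp : p ∈ polySpace d (l + 1)) (i : Fin d) :
    MvPolynomial.pderiv i p ∈ polySpace d l := by
  rw [MvPolynomial.mem_restrictTotalDegree] at hp ⊢
  refine Finset.sup_le fun m hm => ?_
  rw [MvPolynomial.mem_support_iff, MvPolynomial.coeff_pderiv] at hm
  have := MvPolynomial.le_totalDegree (MvPolynomial.mem_support_iff.2 (left_ne_zero_of_mul hm))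
  rw [Finsupp.sum_add_index' (by simp) (by simp)] at this
  simp at this
  have h2 : (m.sum fun _ e => e) = m.degree := rfl
  omega

lemma dnPoly_mem_polySpace {l : ℕ} {p : Poly d} (hp : p ∈ polySpace d (l + 1)) (n : Pt d) :
    dnPoly n p ∈ polySpace d l :=
  Submodule.sum_mem _ fun i _ => Submodule.smul_mem _ _ (pderiv_mem_polySpace hp i)

/-- The affine polynomials are those with vanishing second derivatives. -/
lemma mem_polySpace_one_iff {p : Poly d} :
    p ∈ polySpace d 1 ↔ ∀ i j, MvPolynomial.pderiv i (MvPolynomial.pderiv j p) = 0 := by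
  constructor
  · intro hp i j
    have h := pderiv_mem_polySpace (l := 0) hp j
    rw [MvPolynomial.mem_restrictTotalDegree, Nat.le_zero,
      MvPolynomial.totalDegree_eq_zero_iff_eq_C] at h
    rw [h, MvPolynomial.pderiv_C]
  · intro h
    rw [MvPolynomial.mem_restrictTotalDegree]
    refine Finset.sup_le fun m hm => ?_
    have key : ∀ m : Fin d →₀ ℕ, m ≠ 0 → ∃ i m', m = m' + Finsupp.single i 1 := by
      intro m hm
      obtain ⟨i, hi⟩ := Finsupp.ne_iff.1 hm
      refine ⟨i, m - Finsupp.single i 1, ?_⟩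
      rw [tsub_add_cancel_of_le]
      rw [Finsupp.single_le_iff]
      exact Nat.one_le_iff_ne_zero.2 hi
    by_contra hlt
    have hlt : 1 < m.degree := not_le.1 hlt
    obtain ⟨j, m₁, rfl⟩ := key m (by rintro rfl; simp at hlt)
    obtain ⟨i, m₂, rfl⟩ := key m₁ (by rintro rfl; simp at hlt)
    have h0 := congrArg (MvPolynomial.coeff m₂) (h i j)
    rw [MvPolynomial.coeff_pderiv, MvPolynomial.coeff_pderiv, MvPolynomial.coeff_zero] at h0
    have : MvPolynomial.coeff (m₂ + Finsupp.single i 1 + Finsupp.single j 1) p = 0 := by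
      rcases mul_eq_zero.1 h0 with h0 | h0
      · rcases mul_eq_zero.1 h0 with h0 | h0
        · exact h0
        · exact absurd h0 (by positivity)
      · exact absurd h0 (by positivity)
    exact MvPolynomial.mem_support_iff.1 hm this

/-- A polynomial that vanishes on a nonempty open set is zero: the set contains a box. -/
lemma eq_zero_of_isOpen {p : Poly d} {U : Set (Pt d)} (hU : IsOpen U) (hne : U.Nonempty)
    (h : ∀ x ∈ U, polyVal p x = 0) : p = 0 := by
  obtain ⟨x, hx⟩ := hne
  have hV : IsOpen ((WithLp.toLp 2 : (Fin d → ℝ) → Pt d) ⁻¹' U) :=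
    hU.preimage (PiLp.continuous_toLp 2 _)
  obtain ⟨ε, hε, hb⟩ := Metric.isOpen_iff.1 hV (WithLp.ofLp x) hx
  refine MvPolynomial.funext_set (fun i => Metric.ball (x i) ε) (fun i => ?_) fun y hy => ?_
  · rw [Real.ball_eq_Ioo]
    exact Set.Ioo_infinite (by linarith)
  · have : y ∈ Metric.ball (WithLp.ofLp x) ε := by
      rw [ball_pi _ hε]; exact hy
    simpa [polyVal] using h _ (hb this)

lemma hasDerivAt_polyVal_line (p : Poly d) (x e : Pt d) (t : ℝ) :
    HasDerivAt (fun s : ℝ => polyVal p (x + s • e)) (dn e p (x + t • e)) t := by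
  induction p using MvPolynomial.induction_on with
  | C a =>
    simp only [polyVal_C, dn, MvPolynomial.pderiv_C, polyVal_zero, mul_zero, Finset.sum_const_zero]
    exact hasDerivAt_const _ _
  | add p q hp hq => simpa only [polyVal_add, dn_add] using! hp.add hq
  | mul_X p i hp =>
    have hX : HasDerivAt (fun s : ℝ => x i + s * e i) (e i) t := by
      simpa using ((hasDerivAt_id t).mul_const (e i)).const_add (x i)
    have := hp.mul hX
    simp only [polyVal_mul, polyVal_X, PiLp.add_apply, PiLp.smul_apply, smul_eq_mul]
    refine this.congr_deriv ?_
    simp only [dn, MvPolynomial.pderiv_mul, MvPolynomial.pderiv_X, polyVal_add, polyVal_mul,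
      polyVal_X, mul_add, Finset.sum_add_distrib, Finset.sum_mul]
    congr 1
    · rw [← Finset.sum_add_distrib]
      exact Finset.sum_congr rfl fun j _ => by
        simp only [PiLp.add_apply, PiLp.smul_apply, smul_eq_mul]; ring
    · rw [Finset.sum_eq_single i]
      · have h1 : polyVal (1 : Poly d) (x + t • e) = 1 := by simp [polyVal]
        simp [h1]; ring
      · intro j _ hj
        simp [hj.symm]
      · simp

lemma dn_eq_of_mem_polySpace_one {p : Poly d} (hp : p ∈ polySpace d 1) (e x y : Pt d) :
    dn e p x = dn e p y := by
  have h : ∀ i, ∃ c, MvPolynomial.pderiv i p = MvPolynomial.C c := fun i => by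
    have h := pderiv_mem_polySpace (l := 0) hp i
    rw [MvPolynomial.mem_restrictTotalDegree, Nat.le_zero,
      MvPolynomial.totalDegree_eq_zero_iff_eq_C] at h
    exact ⟨_, h⟩
  choose c hc using h
  simp [dn, hc]

lemma polyVal_add_smul {p : Poly d} (hp : p ∈ polySpace d 1) (x e : Pt d) (t : ℝ) :
    polyVal p (x + t • e) = polyVal p x + t * dn e p x := by
  have h : ∀ s, HasDerivAt (fun s : ℝ => polyVal p (x + s • e) - s * dn e p x) 0 s := by
    intro s
    have := (hasDerivAt_polyVal_line p x e s).sub ((hasDerivAt_id s).mul_const (dn e p x))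
    refine this.congr_deriv ?_
    rw [dn_eq_of_mem_polySpace_one hp e _ x]; ring
  have := is_const_of_deriv_eq_zero (fun s => (h s).differentiableAt) (fun s => (h s).deriv) t 0
  simp at this
  linarith

lemma polyVal_eq_add_dn {p : Poly d} (hp : p ∈ polySpace d 1) (x y : Pt d) :
    polyVal p y = polyVal p x + dn (y - x) p x := by
  have := polyVal_add_smul hp x (y - x) 1
  simpa using this

/-- An affine polynomial as an affine map. -/
def affMap {p : Poly d} (hp : p ∈ polySpace d 1) : Pt d →ᵃ[ℝ] ℝ where
  toFun := polyVal p
  linear :=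
    { toFun := fun e => dn e p 0
      map_add' := fun e f => by simp [dn, add_mul, Finset.sum_add_distrib]
      map_smul' := fun c e => by simp [dn, Finset.mul_sum, mul_assoc] }
  map_vadd' := fun x e => by
    have := polyVal_add_smul hp x e 1
    rw [dn_eq_of_mem_polySpace_one hp e x 0] at this
    simp only [one_smul, one_mul] at this
    simp only [vadd_eq_add, LinearMap.coe_mk, AddHom.coe_mk]
    rw [add_comm e x, this, add_comm]

/-- Cauchy-Schwarz for a directional derivative. -/
lemma dn_sq_le (n : Pt d) (p : Poly d) (x : Pt d) :
    dn n p x ^ 2 ≤ ‖n‖ ^ 2 * ∑ i, polyVal (MvPolynomial.pderiv i p) x ^ 2 := by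
  rw [EuclideanSpace.real_norm_sq_eq]
  exact Finset.sum_mul_sq_le_sq_mul_sq _ _ _

lemma dnn_sq_le (n : Pt d) (p : Poly d) (x : Pt d) :
    dnn n p x ^ 2 ≤ ‖n‖ ^ 4 * ∑ i, ∑ j, hess p x i j ^ 2 := by
  have h1 : dnn n p x = ∑ i, n i * ∑ j, n j * hess p x i j := by
    simp only [dnn, Finset.mul_sum]
    exact Finset.sum_congr rfl fun i _ => Finset.sum_congr rfl fun j _ => by ring
  have hn : ‖n‖ ^ 2 = ∑ i, n i ^ 2 := EuclideanSpace.real_norm_sq_eq n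
  calc dnn n p x ^ 2 ≤ (∑ i, n i ^ 2) * ∑ i, (∑ j, n j * hess p x i j) ^ 2 := by
        rw [h1]; exact Finset.sum_mul_sq_le_sq_mul_sq _ _ _
    _ ≤ (∑ i, n i ^ 2) * ∑ i, (∑ j, n j ^ 2) * ∑ j, hess p x i j ^ 2 := by
        refine mul_le_mul_of_nonneg_left (Finset.sum_le_sum fun i _ => ?_)
          (Finset.sum_nonneg fun i _ => sq_nonneg _)
        exact Finset.sum_mul_sq_le_sq_mul_sq _ _ _
    _ = _ := by rw [← Finset.mul_sum, ← hn]; ring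

end Polynomials

/-! ### Linear algebra -/

/-- Lax-Milgram in finite dimension: a definite bilinear form represents every functional. -/
lemma existsUnique_riesz {V : Type*} [AddCommGroup V] [Module ℝ V] [FiniteDimensional ℝ V]
    (B : V →ₗ[ℝ] V →ₗ[ℝ] ℝ) (hB : ∀ x, B x x = 0 → x = 0) (ℓ : V →ₗ[ℝ] ℝ) :
    ∃! u, ∀ w, B u w = ℓ w := by
  have hinj : Function.Injective B := by
    rw [← LinearMap.ker_eq_bot, LinearMap.ker_eq_bot']
    exact fun x hx => hB x (by rw [hx]; rfl)
  have hsurj : Function.Surjective B :=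
    (LinearMap.injective_iff_surjective_of_finrank_eq_finrank
      (Subspace.dual_finrank_eq (K := ℝ) (V := V)).symm).1 hinj
  obtain ⟨u, hu⟩ := hsurj ℓ
  refine ⟨u, fun w => by rw [hu], fun y hy => hinj ?_⟩
  rw [hu]; exact LinearMap.ext hy

/-- Functionals on a finite-dimensional space are bounded with respect to a definite form. -/
lemma exists_functional_sq_le {V : Type*} [AddCommGroup V] [Module ℝ V] [FiniteDimensional ℝ V]
    (B : LinearMap.BilinForm ℝ V) (hs : LinearMap.IsSymm B) (h0 : ∀ x, 0 ≤ B x x)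
    (hB : ∀ x, B x x = 0 → x = 0) (ℓ : V →ₗ[ℝ] ℝ) :
    ∃ C, 0 ≤ C ∧ ∀ v, ℓ v ^ 2 ≤ C * B v v := by
  obtain ⟨u, hu, -⟩ := existsUnique_riesz B hB ℓ
  refine ⟨B u u, h0 u, fun v => ?_⟩
  rw [← hu]
  exact LinearMap.BilinForm.apply_sq_le_of_symm B h0 hs u v

/-! ### An inverse inequality on balls -/

section Inverse

variable {d : ℕ}

/-- The `L²(S)` inner product of polynomials on a compact set `S`. -/
def l2Form {S : Set (Pt d)} (hS : IsCompact S) : LinearMap.BilinForm ℝ (Poly d) :=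
  have hint : ∀ p q : Poly d, IntegrableOn (fun x => polyVal p x * polyVal q x) S := fun p q =>
    ((continuous_polyVal p).mul (continuous_polyVal q)).continuousOn.integrableOn_compact hS
  LinearMap.mk₂ ℝ (fun p q => ∫ x in S, polyVal p x * polyVal q x)
    (fun p p' q => by
      rw [← integral_add (hint _ _) (hint _ _)]; simp [add_mul])
    (fun c p q => by
      rw [smul_eq_mul, ← integral_const_mul]; simp [mul_assoc])
    (fun p q q' => by
      rw [← integral_add (hint _ _) (hint _ _)]; simp [mul_add])
    (fun c p q => by
      rw [smul_eq_mul, ← integral_const_mul]; simp [mul_left_comm])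

lemma l2Form_apply {S : Set (Pt d)} (hS : IsCompact S) (p q : Poly d) :
    l2Form hS p q = ∫ x in S, polyVal p x * polyVal q x := rfl

lemma l2Form_self_nonneg {S : Set (Pt d)} (hS : IsCompact S) (p : Poly d) :
    0 ≤ l2Form hS p p := by
  rw [l2Form_apply]
  exact integral_nonneg fun x => mul_self_nonneg _

/-- A continuous nonnegative function with vanishing integral over `S` vanishes in the interior. -/
lemma eq_zero_of_setIntegral_eq_zero {S : Set (Pt d)} (hS : IsCompact S) {f : Pt d → ℝ}
    (hf : Continuous f) (h0 : ∀ x, 0 ≤ f x) (h : ∫ x in S, f x = 0) :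
    ∀ x ∈ interior S, f x = 0 := by
  have hi : IntegrableOn f S := hf.continuousOn.integrableOn_compact hS
  rw [integral_eq_zero_iff_of_nonneg h0 hi] at h
  have h' : f =ᵐ[volume.restrict (interior S)] fun _ => 0 :=
    ae_mono (Measure.restrict_mono interior_subset le_rfl) h
  exact Measure.eqOn_open_of_ae_eq h' isOpen_interior hf.continuousOn continuousOn_const

lemma eq_zero_of_l2Form_self {S : Set (Pt d)} (hS : IsCompact S) (hne : (interior S).Nonempty)
    {p : Poly d} (h : l2Form hS p p = 0) : p = 0 := by
  refine eq_zero_of_isOpen isOpen_interior hne fun x hx => ?_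
  have := eq_zero_of_setIntegral_eq_zero hS
    ((continuous_polyVal p).mul (continuous_polyVal p)) (fun x => mul_self_nonneg _) h x hx
  simpa using this

/-- On the unit ball: point values of polynomials are controlled by the `L²` norm. -/
lemma exists_polyVal_sq_le_unit (d m : ℕ) (τ : ℝ) :
    ∃ C, 0 ≤ C ∧ ∀ p ∈ polySpace d m, ∀ y ∈ Metric.closedBall (0 : Pt d) τ,
      polyVal p y ^ 2 ≤ C * ∫ x in Metric.closedBall (0 : Pt d) 1, polyVal p x ^ 2 := by
  set V := polySpace d m
  have hc := isCompact_closedBall (0 : Pt d) 1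
  have hne : (interior (Metric.closedBall (0 : Pt d) 1)).Nonempty :=
    ⟨0, interior_mono Metric.ball_subset_closedBall
      (by rw [Metric.isOpen_ball.interior_eq]; simp)⟩
  set B : LinearMap.BilinForm ℝ V := (l2Form hc).compl₁₂ V.subtype V.subtype
  have hBv : ∀ v w : V, B v w = l2Form hc v.1 w.1 := fun v w => rfl
  set b := Module.finBasis ℝ V
  choose C hC0 hC using fun i => exists_functional_sq_le B
    ⟨fun v w => by simp only [hBv, l2Form_apply, mul_comm, RingHom.id_apply]⟩
    (fun v => l2Form_self_nonneg hc _)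
    (fun v hv => Subtype.ext (eq_zero_of_l2Form_self hc hne hv)) (b.coord i)
  choose M hM using fun i => (isCompact_closedBall (0 : Pt d) τ).exists_bound_of_continuousOn
    (continuous_polyVal (b i : Poly d)).continuousOn
  refine ⟨(∑ i, C i) * ∑ i, M i ^ 2, mul_nonneg (Finset.sum_nonneg fun i _ => hC0 i)
    (Finset.sum_nonneg fun i _ => sq_nonneg _), fun p hp y hy => ?_⟩
  have hQ : ∫ x in Metric.closedBall (0 : Pt d) 1, polyVal p x ^ 2 = B ⟨p, hp⟩ ⟨p, hp⟩ := by
    simp only [hBv, l2Form_apply, sq]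
  have hsum : polyVal p y = ∑ i, b.coord i ⟨p, hp⟩ * polyVal (b i : Poly d) y := by
    have := congrArg (fun v : V => polyVal (v : Poly d) y) (b.sum_repr ⟨p, hp⟩)
    simp only [AddSubmonoidClass.coe_finsetSum, SetLike.val_smul, polyVal_sum, polyVal_smul] at this
    exact this.symm
  rw [hQ, hsum]
  refine (Finset.sum_mul_sq_le_sq_mul_sq _ _ _).trans ?_
  rw [mul_right_comm, Finset.sum_mul _ _ (B _ _)]
  refine mul_le_mul (Finset.sum_le_sum fun i _ => hC i _) (Finset.sum_le_sum fun i _ => ?_)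
    (Finset.sum_nonneg fun i _ => sq_nonneg _)
    (Finset.sum_nonneg fun i _ => mul_nonneg (hC0 i) (l2Form_self_nonneg hc _))
  exact sq_le_sq' (neg_le_of_abs_le (hM i y hy)) (le_of_abs_le (hM i y hy))

/-- The polynomial `y ↦ p(x₀ + r y)`. -/
def rescale (x₀ : Pt d) (r : ℝ) (p : Poly d) : Poly d :=
  MvPolynomial.bind₁ (fun i => MvPolynomial.C (x₀ i) + r • MvPolynomial.X i) p

lemma polyVal_rescale (x₀ : Pt d) (r : ℝ) (p : Poly d) (y : Pt d) :
    polyVal (rescale x₀ r p) y = polyVal p (x₀ + r • y) := by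
  induction p using MvPolynomial.induction_on with
  | C a => simp [rescale]
  | add p q hp hq => simp_all [rescale]
  | mul_X p i hp => simp_all [rescale]

lemma rescale_mem {m : ℕ} {p : Poly d} (hp : p ∈ polySpace d m) (x₀ : Pt d) (r : ℝ) :
    rescale x₀ r p ∈ polySpace d m := by
  have hlin : ∀ i, (MvPolynomial.C (x₀ i) + r • MvPolynomial.X i : Poly d).totalDegree ≤ 1 := by
    intro i
    refine (MvPolynomial.totalDegree_add _ _).trans (max_le (by simp) ?_)
    exact (MvPolynomial.totalDegree_smul_le _ _).trans (by simp)
  rw [rescale, MvPolynomial.bind₁, MvPolynomial.aeval_def, MvPolynomial.eval₂_eq]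
  refine Submodule.sum_mem _ fun s hs => ?_
  rw [MvPolynomial.mem_restrictTotalDegree] at hp ⊢
  refine (MvPolynomial.totalDegree_mul _ _).trans ?_
  have h1 : (algebraMap ℝ (Poly d) (MvPolynomial.coeff s p)).totalDegree = 0 :=
    MvPolynomial.totalDegree_C _
  rw [h1, zero_add]
  refine (MvPolynomial.totalDegree_finsetProd _ _).trans (le_trans ?_
    ((MvPolynomial.le_totalDegree hs).trans hp))
  refine Finset.sum_le_sum fun i _ => (MvPolynomial.totalDegree_pow _ _).trans ?_
  exact (Nat.mul_le_mul_left _ (hlin i)).trans (by simp)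

/-- Point values of polynomials of bounded degree near a ball are controlled by the `L²` norm on
a set that contains the ball, with the natural scaling in the radius. -/
lemma exists_polyVal_sq_le (d m : ℕ) (τ : ℝ) :
    ∃ C, 0 ≤ C ∧ ∀ p ∈ polySpace d m, ∀ (x₀ : Pt d) (r : ℝ) (S : Set (Pt d)), 0 < r →
      IsCompact S → Metric.closedBall x₀ r ⊆ S → ∀ y ∈ Metric.closedBall x₀ (τ * r),
      r ^ d * polyVal p y ^ 2 ≤ C * ∫ x in S, polyVal p x ^ 2 := by
  obtain ⟨C, hC0, hC⟩ := exists_polyVal_sq_le_unit d m τ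
  refine ⟨C, hC0, fun p hp x₀ r S hr hS hB y hy => ?_⟩
  have hcont : Continuous fun x => polyVal p x ^ 2 := (continuous_polyVal p).pow 2
  have h1 := hC _ (rescale_mem hp x₀ r) (r⁻¹ • (y - x₀)) (by
    rw [mem_closedBall_iff_norm] at hy
    rw [mem_closedBall_zero_iff, norm_smul, norm_inv, Real.norm_of_nonneg hr.le,
      inv_mul_le_iff₀ hr, mul_comm]
    exact hy)
  simp only [polyVal_rescale] at h1
  rw [smul_inv_smul₀ hr.ne', add_sub_cancel] at h1
  have h2 : ∫ x in Metric.closedBall (0 : Pt d) 1, polyVal p (x₀ + r • x) ^ 2 =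
      (r ^ d)⁻¹ * ∫ x in Metric.closedBall x₀ r, polyVal p x ^ 2 := by
    rw [Measure.setIntegral_comp_smul_of_pos volume (fun z => polyVal p (x₀ + z) ^ 2) _ hr,
      smul_closedBall _ _ zero_le_one, smul_zero, Real.norm_of_nonneg hr.le, mul_one,
      finrank_euclideanSpace_fin, smul_eq_mul]
    congr 1
    have := (measurePreserving_add_left (volume : Measure (Pt d)) x₀).setIntegral_preimage_emb
      (measurableEmbedding_addLeft x₀) (fun x => polyVal p x ^ 2) (Metric.closedBall x₀ r)
    rw [← this]
    congr 2
    ext z; simp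
  rw [h2] at h1
  have hrd : 0 < r ^ d := pow_pos hr d
  calc r ^ d * polyVal p y ^ 2
      ≤ r ^ d * (C * ((r ^ d)⁻¹ * ∫ x in Metric.closedBall x₀ r, polyVal p x ^ 2)) := by gcongr
    _ = C * ∫ x in Metric.closedBall x₀ r, polyVal p x ^ 2 := by field_simp
    _ ≤ C * ∫ x in S, polyVal p x ^ 2 := by
        refine mul_le_mul_of_nonneg_left ?_ hC0
        exact setIntegral_mono_set (μ := volume) (hcont.continuousOn.integrableOn_compact hS)
          (Filter.Eventually.of_forall fun x => sq_nonneg _) hB.eventuallyLE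

end Inverse

/-! ### Geometry of simplices -/

section Geometry

variable {d : ℕ}

lemma isCompact_body (K : Cell d) : IsCompact (body K) :=
  (Set.finite_range _).isCompact_convexHull ℝ

lemma isCompact_facet (K : Cell d) (i : Fin (d + 1)) : IsCompact (facet K i) :=
  ((Set.toFinite _).image _).isCompact_convexHull ℝ

lemma convex_body (K : Cell d) : Convex ℝ (body K) := convex_convexHull ℝ _

lemma facet_subset_body (K : Cell d) (i : Fin (d + 1)) : facet K i ⊆ body K :=
  convexHull_mono (Set.image_subset_range _ _)

lemma point_mem_body (K : Cell d) (i : Fin (d + 1)) : K.points i ∈ body K :=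
  subset_convexHull ℝ _ (Set.mem_range_self i)

lemma dist_le_diamCell (K : Cell d) {x y : Pt d} (hx : x ∈ body K) (hy : y ∈ body K) :
    dist x y ≤ diamCell K :=
  Metric.dist_le_diam_of_mem (isCompact_body K).isBounded hx hy

lemma affineSpan_points (K : Cell d) : affineSpan ℝ (Set.range K.points) = ⊤ := by
  rw [K.independent.affineSpan_eq_top_iff_card_eq_finrank_add_one]
  simp

/-- The vertices of a cell as an affine basis; its coordinates are the barycentric ones. -/
def bary (K : Cell d) : AffineBasis (Fin (d + 1)) ℝ (Pt d) :=
  ⟨K.points, K.independent, affineSpan_points K⟩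

lemma bary_apply (K : Cell d) (i : Fin (d + 1)) : bary K i = K.points i := rfl

lemma mem_body_iff (K : Cell d) (x : Pt d) : x ∈ body K ↔ ∀ i, 0 ≤ (bary K).coord i x := by
  have := (bary K).convexHull_eq_nonneg_coord
  exact Set.ext_iff.1 this x

lemma interior_body_nonempty (K : Cell d) : (interior (body K)).Nonempty :=
  interior_convexHull_nonempty_iff_affineSpan_eq_top.2 (affineSpan_points K)

lemma coord_eq_zero_of_mem_facet (K : Cell d) {i : Fin (d + 1)} {x : Pt d}
    (hx : x ∈ facet K i) : (bary K).coord i x = 0 := by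
  have hconv : Convex ℝ ((bary K).coord i ⁻¹' {0}) := (convex_singleton 0).affine_preimage _
  refine convexHull_min ?_ hconv hx
  rintro _ ⟨j, hj, rfl⟩
  have hj : j ≠ i := hj
  rw [← bary_apply]
  simp [(bary K).coord_apply_ne hj.symm]

/-- The surface measure on a facet. -/
abbrev faceMeasure (K : Cell d) (i : Fin (d + 1)) : Measure (facet K i) :=
  Measure.comap (Subtype.val : facet K i → Pt d) μHE[d - 1]

lemma faceMeasure_apply (K : Cell d) (i : Fin (d + 1)) (s : Set (facet K i)) :
    faceMeasure K i s = (μHE[d - 1] : Measure (Pt d)) (Subtype.val '' s) :=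
  (MeasurableEmbedding.subtype_coe (isCompact_facet K i).measurableSet).comap_apply _ _

instance (K : Cell d) (i : Fin (d + 1)) : CompactSpace (facet K i) :=
  isCompact_iff_compactSpace.1 (isCompact_facet K i)

lemma faceMeasure_univ (K : Cell d) (i : Fin (d + 1)) :
    faceMeasure K i Set.univ = (μHE[d - 1] : Measure (Pt d)) (facet K i) := by
  rw [faceMeasure_apply, Set.image_univ, Subtype.range_coe]

variable [NeZero d]

lemma diamCell_pos (K : Cell d) : 0 < diamCell K := by
  have hd : (0 : Fin (d + 1)) ≠ Fin.last d := by
    intro h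
    exact NeZero.ne d (by simpa using (congrArg Fin.val h).symm)
  have := dist_pos.2 (K.independent.injective.ne hd)
  exact this.trans_le (dist_le_diamCell K (point_mem_body K _) (point_mem_body K _))

lemma norm_normal (K : Cell d) (i : Fin (d + 1)) : ‖normal K i‖ = 1 := by
  rw [normal, norm_smul, norm_inv, Real.norm_of_nonneg (K.height_pos i).le,
    ← dist_eq_norm, dist_comm]
  exact inv_mul_cancel₀ (K.height_pos i).ne'

lemma normal_mem_orthogonal (K : Cell d) (i : Fin (d + 1)) :
    normal K i ∈ (vectorSpan ℝ (facet K i))ᗮ := by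
  have h1 : vectorSpan ℝ (facet K i) = vectorSpan ℝ (K.points '' {i}ᶜ) := by
    rw [← direction_affineSpan, facet, affineSpan_convexHull, direction_affineSpan]
  rw [h1]
  refine Submodule.smul_mem _ _ ?_
  have h2 : K.altitudeFoot i - K.points i ∈ (K.altitude i).direction :=
    AffineSubspace.vsub_mem_direction (K.altitudeFoot_mem_altitude i) (K.mem_altitude i)
  rw [K.direction_altitude] at h2
  exact h2.1

lemma finrank_vectorSpan_facet (K : Cell d) (i : Fin (d + 1)) :
    Module.finrank ℝ (vectorSpan ℝ (facet K i)) = d - 1 := by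
  have h1 : vectorSpan ℝ (facet K i) = vectorSpan ℝ (Set.range (K.faceOpposite i).points) := by
    rw [← direction_affineSpan, facet, affineSpan_convexHull, direction_affineSpan,
      Affine.Simplex.range_faceOpposite_points]
  rw [h1]
  exact (K.faceOpposite i).independent.finrank_vectorSpan (by simp)

/-- A shared facet determines the normal up to its sign. -/
lemma normal_eq_or_eq_neg {K L : Cell d} {i j : Fin (d + 1)} (h : facet L j = facet K i) :
    normal L j = normal K i ∨ normal L j = -normal K i := by
  have h1 := normal_mem_orthogonal K i
  have h2 := normal_mem_orthogonal L j
  rw [h] at h2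
  have hf : Module.finrank ℝ (vectorSpan ℝ (facet K i))ᗮ = 1 := by
    have := Submodule.finrank_add_finrank_orthogonal (vectorSpan ℝ (facet K i))
    rw [finrank_vectorSpan_facet, finrank_euclideanSpace_fin] at this
    have := NeZero.pos d
    omega
  have hK : normal K i ≠ 0 := by
    rw [← norm_ne_zero_iff, norm_normal]; exact one_ne_zero
  obtain ⟨c, hc⟩ := (finrank_eq_one_iff_of_nonzero' (⟨normal K i, h1⟩ : (vectorSpan ℝ (facet K i))ᗮ)
    (by simpa [Subtype.ext_iff] using hK)).1 hf ⟨normal L j, h2⟩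
  have hc : c • normal K i = normal L j := congrArg Subtype.val hc
  have hn := congrArg norm hc
  rw [norm_smul, norm_normal, norm_normal, mul_one, Real.norm_eq_abs] at hn
  rcases eq_or_eq_neg_of_abs_eq hn with rfl | rfl
  · left; simpa using hc.symm
  · right; simpa using hc.symm

/-- A facet is isometric to a convex body in `ℝ^(d-1)`. -/
lemma exists_facet_param (K : Cell d) (i : Fin (d + 1)) :
    ∃ (ι : EuclideanSpace ℝ (Fin (d - 1)) → Pt d) (T : Set (EuclideanSpace ℝ (Fin (d - 1)))),
      Isometry ι ∧ Convex ℝ T ∧ IsCompact T ∧ (interior T).Nonempty ∧ ι '' T = facet K i := by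
  set s := K.faceOpposite i
  set D := vectorSpan ℝ (Set.range s.points)
  have hD : Module.finrank ℝ D = d - 1 := s.independent.finrank_vectorSpan (by simp)
  let e : D ≃ₗᵢ[ℝ] EuclideanSpace ℝ (Fin (d - 1)) :=
    ((stdOrthonormalBasis ℝ D).reindex (finCongr hD)).repr
  let ι : EuclideanSpace ℝ (Fin (d - 1)) →ᵃ[ℝ] Pt d :=
    (AffineEquiv.vaddConst ℝ (s.points 0)).toAffineMap.comp
      ((D.subtype.comp e.symm.toLinearEquiv.toLinearMap).toAffineMap)
  have hι : ∀ v, ι v = (e.symm v : Pt d) + s.points 0 := fun v => rfl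
  have hiso : Isometry ι := by
    refine Isometry.of_dist_eq fun v w => ?_
    rw [hι, hι, dist_add_right]
    exact (e.symm.isometry.dist_eq v w)
  let b : Fin (d - 1 + 1) → EuclideanSpace ℝ (Fin (d - 1)) := fun j =>
    e ⟨s.points j - s.points 0, vsub_mem_vectorSpan ℝ (Set.mem_range_self _) (Set.mem_range_self _)⟩
  have hb : ∀ j, ι (b j) = s.points j := fun j => by simp [hι, b]
  have hind : AffineIndependent ℝ b := by
    refine AffineIndependent.of_comp ι ?_
    have : ι ∘ b = s.points := funext hb
    rw [this]; exact s.independent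
  refine ⟨ι, convexHull ℝ (Set.range b), hiso, convex_convexHull ℝ _,
    (Set.finite_range _).isCompact_convexHull ℝ, ?_, ?_⟩
  · rw [interior_convexHull_nonempty_iff_affineSpan_eq_top,
      hind.affineSpan_eq_top_iff_card_eq_finrank_add_one]
    simp
  · rw [ι.image_convexHull, ← Set.range_comp, facet, ← Affine.Simplex.range_faceOpposite_points]
    congr 2
    exact funext hb

/-- The surface measure of a facet is at most `C h_K^(d-1)`. -/
lemma exists_facet_measure_le (d : ℕ) [NeZero d] :
    ∃ C : ℝ, 0 ≤ C ∧ ∀ (K : Cell d) (i : Fin (d + 1)),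
      (μHE[d - 1] : Measure (Pt d)) (facet K i) ≤ ENNReal.ofReal (C * diamCell K ^ (d - 1)) := by
  set μ := (volume : Measure (EuclideanSpace ℝ (Fin (d - 1))))
  refine ⟨(μ (Metric.closedBall 0 1)).toReal, ENNReal.toReal_nonneg, fun K i => ?_⟩
  obtain ⟨ι, T, hι, -, hT, ⟨c, hc⟩, hιT⟩ := exists_facet_param K i
  have hsub : T ⊆ Metric.closedBall c (diamCell K) := fun x hx => by
    rw [Metric.mem_closedBall, ← hι.dist_eq]
    exact dist_le_diamCell K (facet_subset_body K i (hιT ▸ Set.mem_image_of_mem ι hx))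
      (facet_subset_body K i (hιT ▸ Set.mem_image_of_mem ι (interior_subset hc)))
  rw [← hιT, hι.euclideanHausdorffMeasure_image,
    EuclideanSpace.euclideanHausdorffMeasure_eq_volume]
  refine (measure_mono hsub).trans_eq ?_
  rw [Measure.addHaar_closedBall' _ _ (diamCell_pos K).le, finrank_euclideanSpace_fin, mul_comm,
    ENNReal.ofReal_mul ENNReal.toReal_nonneg, ENNReal.ofReal_toReal]
  exact (isCompact_closedBall _ _).measure_lt_top.ne

instance (K : Cell d) (i : Fin (d + 1)) : IsFiniteMeasure (faceMeasure K i) := by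
  obtain ⟨C, -, hC⟩ := exists_facet_measure_le d
  exact ⟨by rw [faceMeasure_univ]; exact (hC K i).trans_lt ENNReal.ofReal_lt_top⟩

instance (K : Cell d) (i : Fin (d + 1)) : (faceMeasure K i).IsOpenPosMeasure := by
  refine ⟨fun U hU ⟨x, hx⟩ => ?_⟩
  obtain ⟨V, hV, rfl⟩ := isOpen_induced_iff.1 hU
  obtain ⟨ι, T, hι, hTc, hT, hne, hιT⟩ := exists_facet_param K i
  have himg : (Subtype.val '' (Subtype.val ⁻¹' V : Set (facet K i))) = ι '' (T ∩ ι ⁻¹' V) := by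
    rw [Subtype.image_preimage_coe, Set.image_inter_preimage, hιT]
  rw [faceMeasure_apply, himg, hι.euclideanHausdorffMeasure_image,
    EuclideanSpace.euclideanHausdorffMeasure_eq_volume]
  have hx' : (x : Pt d) ∈ ι '' T := by rw [hιT]; exact x.2
  obtain ⟨y, hy, hyx⟩ := hx'
  have hycl : y ∈ closure (interior T) := by
    rw [hTc.closure_interior_eq_closure_of_nonempty_interior hne]
    exact subset_closure hy
  have hopen : IsOpen (ι ⁻¹' V) := hV.preimage hι.continuous
  obtain ⟨z, hz1, hz2⟩ := mem_closure_iff.1 hycl _ hopen (by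
    rw [Set.mem_preimage, hyx]; exact hx)
  have hpos := (hopen.inter isOpen_interior).measure_pos volume ⟨z, hz1, hz2⟩
  refine (hpos.trans_le (measure_mono ?_)).ne'
  exact fun w hw => ⟨interior_subset hw.2, hw.1⟩

end Geometry

/-! ### Inner products on a cell and on its boundary -/

section Forms

variable {d : ℕ}

/-- The bilinear form `(∇²p, ∇²q)_K`. -/
def hessForm (K : Cell d) : LinearMap.BilinForm ℝ (Poly d) :=
  ∑ i, ∑ j, (l2Form (isCompact_body K)).compl₁₂
    ((MvPolynomial.pderiv i).toLinearMap ∘ₗ (MvPolynomial.pderiv j).toLinearMap)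
    ((MvPolynomial.pderiv i).toLinearMap ∘ₗ (MvPolynomial.pderiv j).toLinearMap)

lemma hessForm_eq_sum (K : Cell d) (p q : Poly d) : hessForm K p q = ∑ i, ∑ j,
    l2Form (isCompact_body K) (MvPolynomial.pderiv i (MvPolynomial.pderiv j p))
      (MvPolynomial.pderiv i (MvPolynomial.pderiv j q)) := by
  simp [hessForm, LinearMap.sum_apply]

lemma hessForm_apply (K : Cell d) (p q : Poly d) : hessForm K p q = hessInner K p q := by
  rw [hessForm_eq_sum]
  simp only [l2Form_apply, hessInner, hess, Matrix.of_apply]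
  have hint : ∀ p q : Poly d, IntegrableOn (fun x => polyVal p x * polyVal q x) (body K) :=
    fun p q => ((continuous_polyVal p).mul (continuous_polyVal q)).continuousOn.integrableOn_compact
      (isCompact_body K)
  rw [integral_finsetSum _ fun i _ => integrable_finsetSum _ fun j _ => hint _ _]
  exact Finset.sum_congr rfl fun i _ => (integral_finsetSum _ fun j _ => hint _ _).symm

lemma hessForm_self_nonneg (K : Cell d) (p : Poly d) : 0 ≤ hessForm K p p := by
  rw [hessForm_eq_sum]
  exact Finset.sum_nonneg fun i _ => Finset.sum_nonneg fun j _ => l2Form_self_nonneg _ _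

lemma mem_polySpace_one_of_hessForm_self {K : Cell d} {p : Poly d} (h : hessForm K p p = 0) :
    p ∈ polySpace d 1 := by
  rw [hessForm_eq_sum, Finset.sum_eq_zero_iff_of_nonneg fun i _ =>
    Finset.sum_nonneg fun j _ => l2Form_self_nonneg _ _] at h
  refine mem_polySpace_one_iff.2 fun i j => ?_
  have hi := h i (Finset.mem_univ _)
  rw [Finset.sum_eq_zero_iff_of_nonneg fun j _ => l2Form_self_nonneg _ _] at hi
  exact eq_zero_of_l2Form_self (isCompact_body K) (interior_body_nonempty K)
    (hi j (Finset.mem_univ _))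

lemma cellInner_eq (K : Cell d) (p q : Poly d) :
    cellInner K p q = l2Form (isCompact_body K) p q := rfl

lemma eq_zero_of_cellInner_self {K : Cell d} {p : Poly d} (h : cellInner K p p = 0) : p = 0 :=
  eq_zero_of_l2Form_self (isCompact_body K) (interior_body_nonempty K) h

lemma facePoly_continuous {l : ℕ} {F : Set (Pt d)} {g : F → ℝ} (hg : g ∈ facePoly l F) :
    Continuous g := by
  obtain ⟨p, -, hp⟩ := hg
  rw [show g = fun x : F => polyVal p x from funext hp]
  exact (continuous_polyVal p).comp continuous_subtype_val

instance (l : ℕ) (F : Set (Pt d)) : FiniteDimensional ℝ (facePoly l F) := by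
  let f : polySpace d l →ₗ[ℝ] (F → ℝ) :=
    { toFun := fun p x => polyVal (p : Poly d) x
      map_add' := fun p q => by ext; simp
      map_smul' := fun c p => by ext; simp }
  have : facePoly l F = LinearMap.range f := by
    ext g
    constructor
    · rintro ⟨p, hp, hg⟩
      exact ⟨⟨p, hp⟩, funext fun x => (hg x).symm⟩
    · rintro ⟨p, rfl⟩
      exact ⟨p, p.2, fun x => rfl⟩
  rw [this]
  infer_instance

/-- The functions on `∂K` that are continuous on each face. -/
def contBd (K : Cell d) : Submodule ℝ (BdFun K) where
  carrier := {φ | ∀ i, Continuous (φ i)}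
  zero_mem' := fun _ => continuous_const
  add_mem' := fun h h' i => (h i).add (h' i)
  smul_mem' := fun c _ h i => (h i).const_smul c

lemma mem_contBd_of_facePoly {l : ℕ} {K : Cell d} {φ : BdFun K}
    (h : ∀ i, φ i ∈ facePoly l (facet K i)) : φ ∈ contBd K :=
  fun i => facePoly_continuous (h i)

lemma faceInner_comm {F : Set (Pt d)} (f g : F → ℝ) : faceInner F f g = faceInner F g f := by
  simp only [faceInner, mul_comm]

lemma faceInner_smul_left {F : Set (Pt d)} (c : ℝ) (f g : F → ℝ) :
    faceInner F (c • f) g = c * faceInner F f g := by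
  simp only [faceInner]
  rw [← integral_const_mul]
  simp [mul_assoc]

lemma faceInner_self_nonneg {F : Set (Pt d)} (f : F → ℝ) : 0 ≤ faceInner F f f :=
  integral_nonneg fun _ => mul_self_nonneg _

variable [NeZero d]

lemma integrable_mul {K : Cell d} {i : Fin (d + 1)} {f g : facet K i → ℝ} (hf : Continuous f)
    (hg : Continuous g) : Integrable (fun x => f x * g x) (faceMeasure K i) :=
  (hf.mul hg).integrable_of_hasCompactSupport (HasCompactSupport.of_compactSpace _)

lemma faceInner_add_left {K : Cell d} {i : Fin (d + 1)} {f f' g : facet K i → ℝ}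
    (hf : Continuous f) (hf' : Continuous f') (hg : Continuous g) :
    faceInner (facet K i) (f + f') g = faceInner (facet K i) f g + faceInner (facet K i) f' g := by
  simp only [faceInner]
  rw [← integral_add (integrable_mul hf hg) (integrable_mul hf' hg)]
  simp [add_mul]

lemma eq_zero_of_faceInner_self {K : Cell d} {i : Fin (d + 1)} {f : facet K i → ℝ}
    (hf : Continuous f) (h : faceInner (facet K i) f f = 0) : f = 0 := by
  have h' := (integral_eq_zero_iff_of_nonneg (fun x => mul_self_nonneg (f x))
    (integrable_mul hf hf)).1 h
  have h2 : (fun x => f x * f x) = fun _ => 0 :=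
    (Continuous.ae_eq_iff_eq (faceMeasure K i) (hf.mul hf) continuous_const).1 h'
  funext x
  simpa using congrFun h2 x

/-- The inner product of `L²(∂K)` on functions that are continuous on each face. -/
def bdForm (K : Cell d) : LinearMap.BilinForm ℝ (contBd K) :=
  have hadd : ∀ φ φ' ψ : contBd K,
      bdInner K (φ + φ' : contBd K) ψ = bdInner K φ ψ + bdInner K φ' ψ := fun φ φ' ψ => by
    simp only [bdInner, ← Finset.sum_add_distrib]
    exact Finset.sum_congr rfl fun i _ => faceInner_add_left (φ.2 i) (φ'.2 i) (ψ.2 i)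
  have hsmul : ∀ (c : ℝ) (φ ψ : contBd K), bdInner K (c • φ : contBd K) ψ = c * bdInner K φ ψ :=
    fun c φ ψ => by
      simp only [bdInner, Finset.mul_sum]
      exact Finset.sum_congr rfl fun i _ => faceInner_smul_left _ _ _
  have hcomm : ∀ φ ψ : contBd K, bdInner K φ ψ = bdInner K ψ φ := fun φ ψ =>
    Finset.sum_congr rfl fun i _ => faceInner_comm _ _
  LinearMap.mk₂ ℝ (fun φ ψ => bdInner K φ ψ) hadd hsmul
    (fun φ ψ ψ' => by rw [hcomm, hadd, hcomm ψ, hcomm ψ'])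
    (fun c φ ψ => by rw [hcomm, hsmul, hcomm ψ, smul_eq_mul])

lemma bdForm_apply (K : Cell d) (φ ψ : contBd K) : bdForm K φ ψ = bdInner K φ ψ := rfl

lemma bdForm_isSymm (K : Cell d) : LinearMap.IsSymm (bdForm K) :=
  ⟨fun φ ψ => by
    rw [bdForm_apply, bdForm_apply, RingHom.id_apply]
    exact Finset.sum_congr rfl fun _ _ => faceInner_comm _ _⟩

lemma bdForm_self_nonneg (K : Cell d) (φ : contBd K) : 0 ≤ bdForm K φ φ := by
  rw [bdForm_apply]
  exact Finset.sum_nonneg fun _ _ => faceInner_self_nonneg _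

lemma eq_zero_of_bdForm_self {K : Cell d} {φ : contBd K} (h : bdForm K φ φ = 0) : φ = 0 := by
  rw [bdForm_apply] at h
  have h' := (Finset.sum_eq_zero_iff_of_nonneg fun i _ => faceInner_self_nonneg (φ.1 i)).1 h
  exact Subtype.ext (funext fun i => eq_zero_of_faceInner_self (φ.2 i) (h' i (Finset.mem_univ _)))

/-- The map `p ↦ ∂_n p` on `∂K`. -/
def dnLin (K : Cell d) : Poly d →ₗ[ℝ] contBd K where
  toFun p := ⟨dnBd K p, fun i => by
    change Continuous fun x : facet K i => dn (normal K i) p x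
    simp only [← polyVal_dnPoly]
    exact (continuous_polyVal _).comp continuous_subtype_val⟩
  map_add' p q := by ext; simp [dnBd, dn_add]
  map_smul' c p := by ext; simp [dnBd, dn_smul]

/-- The map `p ↦ ∂_{nn} p` on `∂K`. -/
def dnnLin (K : Cell d) : Poly d →ₗ[ℝ] contBd K where
  toFun p := ⟨dnnBd K p, fun i => by
    change Continuous fun x : facet K i => dnn (normal K i) p x
    simp only [← polyVal_dnPoly_dnPoly]
    exact (continuous_polyVal _).comp continuous_subtype_val⟩
  map_add' p q := by
    ext; simp [dnnBd, dnn, hess_add, mul_add, add_mul, Finset.sum_add_distrib]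
  map_smul' c p := by
    ext i x
    change dnn (normal K i) (c • p) x = c * dnn (normal K i) p x
    simp only [dnn, hess_smul, Matrix.smul_apply, smul_eq_mul, Finset.mul_sum]
    exact Finset.sum_congr rfl fun i _ => Finset.sum_congr rfl fun j _ => by ring

lemma dnnLin_coe (K : Cell d) (p : Poly d) : (dnnLin K p : BdFun K) = dnnBd K p := rfl

lemma dnnBd_mem_facePoly {k : ℕ} (K : Cell d) {p : Poly d} (hp : p ∈ polySpace d (k + 2))
    (i : Fin (d + 1)) : dnnBd K p i ∈ facePoly k (facet K i) :=
  ⟨_, dnPoly_mem_polySpace (dnPoly_mem_polySpace hp (normal K i)) (normal K i),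
    fun _ => (polyVal_dnPoly_dnPoly _ _ _).symm⟩

/-! ### The projection onto polynomials on the faces -/

lemma exists_isFaceProj (k : ℕ) {K : Cell d} {i : Fin (d + 1)} {f : facet K i → ℝ}
    (hf : Continuous f) : ∃ q, IsFaceProj k (facet K i) f q := by
  let V := facePoly k (facet K i)
  have hc : ∀ v : V, Continuous (v : facet K i → ℝ) := fun v => facePoly_continuous v.2
  have hadd : ∀ u v w : V, faceInner (facet K i) (u + v : V) w =
      faceInner (facet K i) u w + faceInner (facet K i) v w := fun u v w =>
    faceInner_add_left (hc u) (hc v) (hc w)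
  let B : V →ₗ[ℝ] V →ₗ[ℝ] ℝ := LinearMap.mk₂ ℝ (fun u v => faceInner (facet K i) u v) hadd
    (fun c u v => faceInner_smul_left _ _ _)
    (fun u v w => by rw [faceInner_comm, hadd, faceInner_comm, faceInner_comm w.1])
    (fun c u v => by
      rw [faceInner_comm, smul_eq_mul, faceInner_comm u.1]; exact faceInner_smul_left _ _ _)
  let ℓ : V →ₗ[ℝ] ℝ :=
    { toFun := fun v => faceInner (facet K i) v f
      map_add' := fun u v => faceInner_add_left (hc u) (hc v) hf
      map_smul' := fun c u => faceInner_smul_left _ _ _ }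
  obtain ⟨q, hq, -⟩ := existsUnique_riesz B
    (fun v hv => Subtype.ext (eq_zero_of_faceInner_self (hc v) hv)) ℓ
  refine ⟨q, q.2, fun r hr => ?_⟩
  have h1 : faceInner (facet K i) q r = faceInner (facet K i) r f := hq ⟨r, hr⟩
  have hneg : (f - q.1 : facet K i → ℝ) = f + (-1 : ℝ) • q.1 := by
    rw [neg_one_smul, sub_eq_add_neg]
  rw [hneg, faceInner_add_left hf ((hc q).const_smul _) (facePoly_continuous hr),
    faceInner_smul_left, h1, faceInner_comm f]
  ring

lemma bdProj_spec (k : ℕ) (K : Cell d) (φ : contBd K) (i : Fin (d + 1)) :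
    IsFaceProj k (facet K i) (φ.1 i) (bdProj k K φ i) :=
  Classical.epsilon_spec (exists_isFaceProj k (φ.2 i))

/-- The projection `Π^k_{∂K} φ` as a function continuous on each face. -/
def bdProjC (k : ℕ) (K : Cell d) (φ : contBd K) : contBd K :=
  ⟨bdProj k K φ, mem_contBd_of_facePoly fun i => (bdProj_spec k K φ i).1⟩

/-- The defining orthogonality of the projection. -/
lemma bdForm_bdProjC {k : ℕ} {K : Cell d} (φ ψ : contBd K)
    (hψ : ∀ i, ψ.1 i ∈ facePoly k (facet K i)) :
    bdForm K (bdProjC k K φ) ψ = bdForm K φ ψ := by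
  have h : bdForm K (φ - bdProjC k K φ) ψ = 0 := by
    rw [bdForm_apply]
    exact Finset.sum_eq_zero fun i _ => (bdProj_spec k K φ i).2 _ (hψ i)
  rw [map_sub, LinearMap.sub_apply] at h
  linarith

lemma bdForm_bdProjC_self (k : ℕ) (K : Cell d) (φ ψ : contBd K) :
    bdForm K (bdProjC k K φ) ψ = bdForm K (bdProjC k K φ) (bdProjC k K ψ) := by
  have h := bdForm_bdProjC (k := k) ψ (bdProjC k K φ) fun i => (bdProj_spec k K φ i).1
  have hs := (bdForm_isSymm K).eq
  simp only [RingHom.id_apply] at hs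
  rw [hs, ← h, hs]

/-- Pythagoras for the projection. -/
lemma bdForm_pythagoras (k : ℕ) (K : Cell d) (φ : contBd K) :
    bdForm K φ φ = bdForm K (bdProjC k K φ) (bdProjC k K φ) +
      bdForm K (φ - bdProjC k K φ) (φ - bdProjC k K φ) := by
  have h1 := bdForm_bdProjC_self k K φ φ
  have hs := (bdForm_isSymm K).eq φ (bdProjC k K φ)
  simp only [RingHom.id_apply] at hs
  simp only [map_sub, LinearMap.sub_apply]
  linarith

/-- The projection is a best approximation. -/
lemma bdForm_sub_bdProjC_le {k : ℕ} {K : Cell d} (φ ψ : contBd K)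
    (hψ : ∀ i, ψ.1 i ∈ facePoly k (facet K i)) :
    bdForm K (φ - bdProjC k K φ) (φ - bdProjC k K φ) ≤ bdForm K (φ - ψ) (φ - ψ) := by
  set π := bdProjC k K φ
  have h0 := bdForm_bdProjC (k := k) φ (π - ψ) fun i =>
    Submodule.sub_mem _ (bdProj_spec k K φ i).1 (hψ i)
  have h1 := bdForm_self_nonneg K (π - ψ)
  have hs := (bdForm_isSymm K).eq
  simp only [RingHom.id_apply] at hs
  have e1 := hs φ π
  have e2 := hs φ ψ
  have e3 := hs π ψ
  simp only [map_sub, LinearMap.sub_apply] at h0 h1 ⊢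
  change bdForm K π π - bdForm K π ψ = _ at h0
  linarith

end Forms

section Local

variable {d : ℕ}

/-! ### Inverse and trace inequalities on shape-regular cells -/

/-- The cell `K` is shape-regular with parameter `σ`. -/
def RegularCell (σ : ℝ) (K : Cell d) : Prop :=
  ∃ x r, 0 < r ∧ Metric.closedBall x r ⊆ body K ∧ diamCell K ≤ σ * (2 * r)

/-- The Hessian of a polynomial is bounded pointwise on `K` by its `L²(K)` norm. -/
lemma exists_hess_sq_le (d k : ℕ) [NeZero d] (σ : ℝ) :
    ∃ C, 0 ≤ C ∧ ∀ K : Cell d, RegularCell σ K → ∀ p ∈ polySpace d (k + 2), ∀ y ∈ body K,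
      diamCell K ^ d * ∑ i, ∑ j, hess p y i j ^ 2 ≤ C * hessForm K p p := by
  obtain ⟨C, hC0, hC⟩ := exists_polyVal_sq_le d k (σ * 2)
  refine ⟨|σ * 2| ^ d * C, by positivity, ?_⟩
  rintro K ⟨x, r, hr, hB, hdiam⟩ p hp y hy
  have hh : diamCell K ^ d ≤ |σ * 2| ^ d * r ^ d := by
    rw [← mul_pow]
    refine pow_le_pow_left₀ (diamCell_pos K).le (hdiam.trans ?_) d
    rw [← mul_assoc]
    exact mul_le_mul_of_nonneg_right (le_abs_self _) hr.le
  have hy' : y ∈ Metric.closedBall x (σ * 2 * r) := by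
    rw [Metric.mem_closedBall, mul_assoc]
    exact (dist_le_diamCell K hy (hB (Metric.mem_closedBall_self hr.le))).trans hdiam
  have hkey : r ^ d * ∑ i, ∑ j, hess p y i j ^ 2 ≤ C * hessForm K p p := by
    rw [hessForm_eq_sum]
    simp only [Finset.mul_sum]
    refine Finset.sum_le_sum fun i _ => Finset.sum_le_sum fun j _ => ?_
    have := hC _ (pderiv_mem_polySpace (pderiv_mem_polySpace hp j) i) x r (body K) hr
      (isCompact_body K) hB y hy'
    simpa only [l2Form_apply, ← sq] using! this
  have hnn : 0 ≤ ∑ i, ∑ j, hess p y i j ^ 2 :=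
    Finset.sum_nonneg fun i _ => Finset.sum_nonneg fun j _ => sq_nonneg _
  calc diamCell K ^ d * ∑ i, ∑ j, hess p y i j ^ 2
      ≤ |σ * 2| ^ d * r ^ d * ∑ i, ∑ j, hess p y i j ^ 2 := by gcongr
    _ = |σ * 2| ^ d * (r ^ d * ∑ i, ∑ j, hess p y i j ^ 2) := by ring
    _ ≤ |σ * 2| ^ d * (C * hessForm K p p) := by gcongr
    _ = _ := by ring

/-- A pointwise bound on `∂K` bounds the `L²(∂K)` norm. -/
lemma exists_bdForm_self_le (d : ℕ) [NeZero d] :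
    ∃ C, 0 ≤ C ∧ ∀ (K : Cell d) (φ : contBd K) (b : ℝ),
      (∀ i x, diamCell K ^ d * φ.1 i x ^ 2 ≤ b) → bdForm K φ φ ≤ C * (diamCell K)⁻¹ * b := by
  obtain ⟨C, hC0, hC⟩ := exists_facet_measure_le d
  refine ⟨(d + 1) * C, by positivity, fun K φ b hb => ?_⟩
  have hh := diamCell_pos K
  have hface : ∀ i, faceInner (facet K i) (φ.1 i) (φ.1 i) ≤ C * (diamCell K)⁻¹ * b := by
    intro i
    have hm : (faceMeasure K i).real Set.univ ≤ C * diamCell K ^ (d - 1) := by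
      rw [Measure.real, faceMeasure_univ]
      exact ENNReal.toReal_le_of_le_ofReal (by positivity) (hC K i)
    have hb0 : 0 ≤ b := by
      have : (facet K i).Nonempty := by
        obtain ⟨j, hj⟩ : ∃ j, j ≠ i := by
          have : Nontrivial (Fin (d + 1)) := Fin.nontrivial_iff_two_le.2 (by
            have := NeZero.pos d; omega)
          exact exists_ne i
        exact ⟨_, subset_convexHull ℝ _ ⟨j, hj, rfl⟩⟩
      obtain ⟨x, hx⟩ := this
      exact le_trans (by positivity) (hb i ⟨x, hx⟩)
    have h1 : faceInner (facet K i) (φ.1 i) (φ.1 i) ≤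
        ∫ _, b / diamCell K ^ d ∂faceMeasure K i := by
      refine integral_mono (integrable_mul (φ.2 i) (φ.2 i)) (integrable_const _) fun x => ?_
      change φ.1 i x * φ.1 i x ≤ _
      rw [← sq, le_div_iff₀ (by positivity), mul_comm]
      exact hb i x
    rw [integral_const, smul_eq_mul] at h1
    refine h1.trans ?_
    calc _ ≤ C * diamCell K ^ (d - 1) * (b / diamCell K ^ d) := by gcongr
      _ = C * (diamCell K)⁻¹ * b := by
        have : diamCell K ^ d = diamCell K ^ (d - 1) * diamCell K := by
          rw [← pow_succ, Nat.sub_add_cancel (NeZero.pos d)]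
        rw [this]
        field_simp
  rw [bdForm_apply]
  refine (Finset.sum_le_sum fun i _ => hface i).trans ?_
  rw [Finset.sum_const, Finset.card_univ, Fintype.card_fin, nsmul_eq_mul]
  push_cast
  exact le_of_eq (by ring)

/-- Discrete trace inequality for the normal-normal derivative. -/
lemma exists_dnn_trace_le (d k : ℕ) [NeZero d] (σ : ℝ) :
    ∃ C, 0 ≤ C ∧ ∀ K : Cell d, RegularCell σ K → ∀ p ∈ polySpace d (k + 2),
      bdForm K (dnnLin K p) (dnnLin K p) ≤ C * (diamCell K)⁻¹ * hessForm K p p := by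
  obtain ⟨C, hC0, hC⟩ := exists_hess_sq_le d k σ
  obtain ⟨C', hC0', hC'⟩ := exists_bdForm_self_le d
  refine ⟨C' * C, by positivity, fun K hK p hp => ?_⟩
  refine (hC' K _ (C * hessForm K p p) fun i x => ?_).trans (le_of_eq (by ring))
  have hh := diamCell_pos K
  refine le_trans ?_ (hC K hK p hp x (facet_subset_body K i x.2))
  refine mul_le_mul_of_nonneg_left ?_ (by positivity)
  have := dnn_sq_le (normal K i) p x
  rwa [norm_normal, one_pow, one_mul] at this

/-- The normal derivative deviates from its best approximation by constants on the faces at most by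
the Hessian: the comparison value is the derivative at a vertex of the cell. -/
lemma exists_dn_approx_le (d k : ℕ) [NeZero d] (σ : ℝ) :
    ∃ C, 0 ≤ C ∧ ∀ K : Cell d, RegularCell σ K → ∀ p ∈ polySpace d (k + 2),
      ∃ ψ : contBd K, (∀ i, ψ.1 i ∈ facePoly k (facet K i)) ∧
        bdForm K (dnLin K p - ψ) (dnLin K p - ψ) ≤ C * diamCell K * hessForm K p p := by
  obtain ⟨C, hC0, hC⟩ := exists_hess_sq_le d k σ
  obtain ⟨C', hC0', hC'⟩ := exists_bdForm_self_le d
  refine ⟨C' * C, by positivity, fun K hK p hp => ?_⟩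
  have hh := diamCell_pos K
  set x₀ := K.points 0
  refine ⟨⟨fun i _ => dn (normal K i) p x₀, fun i => continuous_const⟩, fun i => ?_, ?_⟩
  · refine ⟨MvPolynomial.C (dn (normal K i) p x₀), ?_, fun x => by simp⟩
    rw [MvPolynomial.mem_restrictTotalDegree]
    simp
  refine (hC' K _ (diamCell K ^ 2 * (C * hessForm K p p)) fun i x => ?_).trans
    (le_of_eq (by field_simp))
  change diamCell K ^ d * (dn (normal K i) p x - dn (normal K i) p x₀) ^ 2 ≤ _
  set n := normal K i
  set e := (x : Pt d) - x₀
  have hx : (x : Pt d) ∈ body K := facet_subset_body K i x.2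
  have hline := fun t => hasDerivAt_polyVal_line (dnPoly n p) x₀ e t
  obtain ⟨t, ht, hslope⟩ := exists_hasDerivAt_eq_slope
    (fun s : ℝ => polyVal (dnPoly n p) (x₀ + s • e)) _ zero_lt_one
    (fun s _ => (hline s).continuousAt.continuousWithinAt) (fun s _ => hline s)
  have hy : x₀ + t • e ∈ body K :=
    (convex_body K).add_smul_sub_mem (point_mem_body K 0) hx ⟨ht.1.le, ht.2.le⟩
  simp only [one_smul, zero_smul, add_zero, sub_zero, div_one, polyVal_dnPoly] at hslope
  rw [show x₀ + e = x from add_sub_cancel _ _] at hslope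
  rw [← hslope]
  have he : ‖e‖ ≤ diamCell K := by
    rw [← dist_eq_norm]
    exact dist_le_diamCell K hx (point_mem_body K 0)
  have h1 := dn_sq_le e (dnPoly n p) (x₀ + t • e)
  have h2 : ∑ i, polyVal (MvPolynomial.pderiv i (dnPoly n p)) (x₀ + t • e) ^ 2 ≤
      ∑ i, ∑ j, hess p (x₀ + t • e) i j ^ 2 := by
    refine Finset.sum_le_sum fun i _ => ?_
    have h3 : polyVal (MvPolynomial.pderiv i (dnPoly n p)) (x₀ + t • e) =
        ∑ j, n j * hess p (x₀ + t • e) i j := by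
      simp [dnPoly, hess]
    rw [h3]
    refine (Finset.sum_mul_sq_le_sq_mul_sq _ _ _).trans ?_
    rw [← EuclideanSpace.real_norm_sq_eq, norm_normal, one_pow, one_mul]
  calc diamCell K ^ d * dn e (dnPoly n p) (x₀ + t • e) ^ 2
      ≤ diamCell K ^ d * (diamCell K ^ 2 * ∑ i, ∑ j, hess p (x₀ + t • e) i j ^ 2) := by
        refine mul_le_mul_of_nonneg_left (h1.trans ?_) (by positivity)
        exact mul_le_mul (pow_le_pow_left₀ (norm_nonneg _) he 2) h2
          (Finset.sum_nonneg fun i _ => sq_nonneg _) (by positivity)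
    _ = diamCell K ^ 2 * (diamCell K ^ d * ∑ i, ∑ j, hess p (x₀ + t • e) i j ^ 2) := by ring
    _ ≤ _ := mul_le_mul_of_nonneg_left (hC K hK p hp _ hy) (by positivity)

/-! ### The reconstruction -/

/-- The polynomials in `ℙ_{k+2}` that are `L²(K)`-orthogonal to `ℙ_1`. -/
def orthoSpace (k : ℕ) (K : Cell d) : Submodule ℝ (Poly d) where
  carrier := {w | w ∈ polySpace d (k + 2) ∧ ∀ ξ ∈ polySpace d 1, cellInner K w ξ = 0}
  zero_mem' := ⟨Submodule.zero_mem _, fun ξ _ => by rw [cellInner_eq]; simp⟩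
  add_mem' := by
    rintro v w ⟨hv, hv'⟩ ⟨hw, hw'⟩
    refine ⟨Submodule.add_mem _ hv hw, fun ξ hξ => ?_⟩
    have h1 := hv' ξ hξ
    have h2 := hw' ξ hξ
    rw [cellInner_eq] at *
    rw [map_add, LinearMap.add_apply, h1, h2, add_zero]
  smul_mem' := by
    rintro c w ⟨hw, hw'⟩
    refine ⟨Submodule.smul_mem _ c hw, fun ξ hξ => ?_⟩
    have h2 := hw' ξ hξ
    rw [cellInner_eq] at *
    rw [map_smul, LinearMap.smul_apply, h2, smul_zero]

instance (k : ℕ) (K : Cell d) : FiniteDimensional ℝ (orthoSpace k K) :=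
  Submodule.finiteDimensional_of_le (S₂ := polySpace d (k + 2)) fun _ hw => hw.1

lemma eq_zero_of_mem_orthoSpace {k : ℕ} {K : Cell d} {w : Poly d} (hw : w ∈ orthoSpace k K)
    (h : hessForm K w w = 0) : w = 0 :=
  eq_zero_of_cellInner_self (hw.2 w (mem_polySpace_one_of_hessForm_self h))

variable [NeZero d]

/-- The face component of a local unknown as a function continuous on each face. -/
def jump {k : ℕ} {K : Cell d} {v : LocalPair K} (hv : v ∈ localSpace k K) : contBd K :=
  ⟨v.2, mem_contBd_of_facePoly fun i => hv.2 i trivial⟩ - dnLin K v.1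

lemma jump_coe {k : ℕ} {K : Cell d} {v : LocalPair K} (hv : v ∈ localSpace k K) :
    (jump hv : BdFun K) = v.2 - dnBd K v.1 := rfl

/-- The defining property of the reconstruction in terms of bilinear forms. -/
lemma isReconstruction_iff {k : ℕ} {K : Cell d} {v : LocalPair K} (hv : v ∈ localSpace k K)
    (r : Poly d) : IsReconstruction k K v r ↔ r - v.1 ∈ orthoSpace k K ∧
      ∀ w ∈ orthoSpace k K, hessForm K (r - v.1) w = bdForm K (jump hv) (dnnLin K w) := by
  have hneg : ∀ w, bdInner K (dnBd K v.1 - v.2) (dnnBd K w) =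
      -bdForm K (jump hv) (dnnLin K w) := fun w => by
    rw [← LinearMap.neg_apply, ← map_neg, bdForm_apply, Submodule.coe_neg, jump_coe, neg_sub,
      dnnLin_coe]
  simp only [IsReconstruction, hneg, ← hessForm_apply, cellInner_eq, map_sub, LinearMap.sub_apply]
  constructor
  · rintro ⟨h1, h2, h3⟩
    refine ⟨⟨Submodule.sub_mem _ h1 hv.1, fun ξ hξ => ?_⟩, fun w hw => ?_⟩
    · rw [cellInner_eq, map_sub, LinearMap.sub_apply, h3 ξ hξ, sub_self]
    · rw [h2 w hw.1 hw.2]; ring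
  · rintro ⟨⟨h1, h3⟩, h2⟩
    refine ⟨by simpa using Submodule.add_mem _ h1 hv.1, fun w hw hw' => ?_, fun ξ hξ => ?_⟩
    · linarith [h2 w ⟨hw, hw'⟩]
    · have := h3 ξ hξ
      rw [cellInner_eq, map_sub, LinearMap.sub_apply] at this
      linarith

lemma existsUnique_isReconstruction {k : ℕ} {K : Cell d} {v : LocalPair K}
    (hv : v ∈ localSpace k K) : ∃! r, IsReconstruction k K v r := by
  let W := orthoSpace k K
  let B : W →ₗ[ℝ] W →ₗ[ℝ] ℝ := (hessForm K).compl₁₂ W.subtype W.subtype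
  obtain ⟨u, hu, huniq⟩ := existsUnique_riesz B
    (fun w hw => Subtype.ext (eq_zero_of_mem_orthoSpace w.2 hw))
    ((bdForm K (jump hv)).comp ((dnnLin K).comp W.subtype))
  refine ⟨u + v.1, (isReconstruction_iff hv _).2 ?_, fun r hr => ?_⟩
  · rw [add_sub_cancel_right]
    exact ⟨u.2, fun w hw => hu ⟨w, hw⟩⟩
  · obtain ⟨h1, h2⟩ := (isReconstruction_iff hv _).1 hr
    have := congrArg Subtype.val (huniq ⟨r - v.1, h1⟩ fun w => h2 w w.2)
    exact sub_eq_iff_eq_add.1 this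

lemma recon_spec {k : ℕ} {K : Cell d} {v : LocalPair K} (hv : v ∈ localSpace k K) :
    IsReconstruction k K v (recon k K v) :=
  Classical.epsilon_spec (existsUnique_isReconstruction hv).exists

lemma stab_eq {k : ℕ} {K : Cell d} {v w : LocalPair K} (hv : v ∈ localSpace k K)
    (hw : w ∈ localSpace k K) : stab k K v w =
      (diamCell K)⁻¹ * bdForm K (bdProjC k K (jump hv)) (jump hw) := rfl

/-! ### Local stability and boundedness -/

lemma self_add_le_two_mul {V : Type*} [AddCommGroup V] [Module ℝ V] (B : LinearMap.BilinForm ℝ V)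
    (h0 : ∀ x, 0 ≤ B x x) (x y : V) : B (x + y) (x + y) ≤ 2 * B x x + 2 * B y y := by
  have := h0 (x - y)
  simp only [map_sub, map_add, LinearMap.sub_apply, LinearMap.add_apply] at this ⊢
  linarith

lemma localEnergy_eq {k : ℕ} {K : Cell d} {v : LocalPair K} (hv : v ∈ localSpace k K) :
    localEnergy K v =
      hessForm K v.1 v.1 + (diamCell K)⁻¹ * bdForm K (jump hv) (jump hv) := by
  rw [localEnergy, hessForm_apply]; rfl

/-- The energy of `R_K v̂ - v` is controlled by the projected jump: the normal-normal derivative of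
a polynomial of degree `k + 2` is a polynomial of degree `k` on each face. -/
lemma hessForm_recon_sub_le {k : ℕ} {K : Cell d} {C : ℝ} (hC : ∀ p ∈ polySpace d (k + 2),
      bdForm K (dnnLin K p) (dnnLin K p) ≤ C * (diamCell K)⁻¹ * hessForm K p p) (hC0 : 0 ≤ C)
    {v : LocalPair K} (hv : v ∈ localSpace k K) :
    hessForm K (recon k K v - v.1) (recon k K v - v.1) ≤ C * stab k K v v := by
  obtain ⟨h1, h2⟩ := (isReconstruction_iff hv _).1 (recon_spec hv)
  set e := recon k K v - v.1
  have hh := diamCell_pos K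
  have he := h2 e h1
  rw [← bdForm_bdProjC (k := k) _ _ (dnnBd_mem_facePoly K h1.1)] at he
  have hcs := LinearMap.BilinForm.apply_sq_le_of_symm (bdForm K) (bdForm_self_nonneg K)
    (bdForm_isSymm K) (bdProjC k K (jump hv)) (dnnLin K e)
  rw [← he] at hcs
  rw [stab_eq hv hv, bdForm_bdProjC_self]
  set N := bdForm K (bdProjC k K (jump hv)) (bdProjC k K (jump hv))
  have hN : 0 ≤ N := bdForm_self_nonneg K _
  set H := hessForm K e e
  have hH : 0 ≤ H := hessForm_self_nonneg K e
  rcases hH.eq_or_lt with h0 | hpos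
  · rw [← h0]; positivity
  · refine le_of_mul_le_mul_right ?_ hpos
    calc H * H ≤ N * (C * (diamCell K)⁻¹ * H) := by
          rw [← sq]; exact hcs.trans (mul_le_mul_of_nonneg_left (hC e h1.1) hN)
      _ = _ := by ring

/-- The local energy is equivalent to the local bilinear form, uniformly on shape-regular cells. -/
lemma exists_local_stability (d k : ℕ) [NeZero d] (σ : ℝ) :
    ∃ α : ℝ, 0 < α ∧ ∀ K : Cell d, RegularCell σ K → ∀ v ∈ localSpace k K,
      α * localEnergy K v ≤ hessInner K (recon k K v) (recon k K v) + stab k K v v ∧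
      hessInner K (recon k K v) (recon k K v) + stab k K v v ≤ α⁻¹ * localEnergy K v := by
  obtain ⟨C, hC0, hC⟩ := exists_dnn_trace_le d k σ
  obtain ⟨D, hD0, hD⟩ := exists_dn_approx_le d k σ
  have hA : 0 < 1 + (1 + D) * (2 + 2 * C) := by positivity
  refine ⟨(1 + (1 + D) * (2 + 2 * C))⁻¹, inv_pos.2 hA, fun K hK v hv => ?_⟩
  have hh := diamCell_pos K
  rw [localEnergy_eq hv, ← hessForm_apply, inv_inv, inv_mul_le_iff₀ hA]
  have hE := hessForm_recon_sub_le (hC K hK) hC0 hv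
  set r := recon k K v
  set δ := jump hv
  have hr : hessForm K r r ≤ 2 * hessForm K (r - v.1) (r - v.1) + 2 * hessForm K v.1 v.1 := by
    have := self_add_le_two_mul (hessForm K) (hessForm_self_nonneg K) (r - v.1) v.1
    rwa [sub_add_cancel] at this
  have hvr : hessForm K v.1 v.1 ≤ 2 * hessForm K r r + 2 * hessForm K (r - v.1) (r - v.1) := by
    have := self_add_le_two_mul (hessForm K) (hessForm_self_nonneg K) r (-(r - v.1))
    rw [show r + -(r - v.1) = v.1 by abel] at this
    simpa only [map_neg, LinearMap.neg_apply, neg_neg] using this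
  have hS : stab k K v v =
      (diamCell K)⁻¹ * bdForm K (bdProjC k K δ) (bdProjC k K δ) := by
    rw [stab_eq hv hv, bdForm_bdProjC_self]
  have hpyth := bdForm_pythagoras k K δ
  -- the part of the jump that the projection removes comes from `∂_n v` alone
  have hrest : (diamCell K)⁻¹ * bdForm K (δ - bdProjC k K δ) (δ - bdProjC k K δ) ≤
      D * hessForm K v.1 v.1 := by
    obtain ⟨ψ, hψ, hψle⟩ := hD K hK v.1 hv.1
    have hbest := bdForm_sub_bdProjC_le (k := k) δ (δ + dnLin K v.1 - ψ) fun i =>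
      Submodule.sub_mem _ (by
        have : (δ + dnLin K v.1 : contBd K).1 i = v.2 i := by
          change (v.2 - dnBd K v.1 + dnBd K v.1) i = v.2 i
          rw [sub_add_cancel]
        rw [this]
        exact hv.2 i trivial) (hψ i)
    rw [show δ - (δ + dnLin K v.1 - ψ) = -(dnLin K v.1 - ψ) by abel] at hbest
    simp only [map_neg, LinearMap.neg_apply, neg_neg] at hbest
    rw [inv_mul_le_iff₀ hh]
    linarith
  have hH0 := hessForm_self_nonneg K v.1
  have hR0 := hessForm_self_nonneg K r
  have hS0 : 0 ≤ stab k K v v := by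
    rw [hS]; exact mul_nonneg (inv_nonneg.2 hh.le) (bdForm_self_nonneg K _)
  have hδ : (diamCell K)⁻¹ * bdForm K δ δ = stab k K v v +
      (diamCell K)⁻¹ * bdForm K (δ - bdProjC k K δ) (δ - bdProjC k K δ) := by
    rw [hS, hpyth]; ring
  have hrest0 : 0 ≤ (diamCell K)⁻¹ * bdForm K (δ - bdProjC k K δ) (δ - bdProjC k K δ) :=
    mul_nonneg (inv_nonneg.2 hh.le) (bdForm_self_nonneg K _)
  rw [hδ]
  set S := stab k K v v
  set H := hessForm K v.1 v.1
  set R := hessForm K r r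
  have hCS := mul_nonneg hC0 hS0
  have hCR := mul_nonneg hC0 hR0
  have hCH := mul_nonneg hC0 hH0
  have hHle : H ≤ (2 + 2 * C) * (R + S) := by nlinarith
  constructor
  · have := mul_le_mul_of_nonneg_left hHle (by positivity : 0 ≤ 1 + D)
    nlinarith
  · have h1 : R + S ≤ (3 + 2 * C) * (H + S) := by nlinarith
    have h2 : 3 + 2 * C ≤ 1 + (1 + D) * (2 + 2 * C) := by nlinarith
    refine h1.trans (mul_le_mul h2 (by linarith) (by positivity) hA.le)

end Local

section Global

variable {d : ℕ}

/-! ### Lines in general position with respect to a cell -/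

/-- An affine function vanishes on the affine span of its zeros. -/
lemma affineMap_eq_zero_of_mem_affineSpan {f : Pt d →ᵃ[ℝ] ℝ} {s : Set (Pt d)}
    (h : ∀ x ∈ s, f x = 0) {x : Pt d} (hx : x ∈ affineSpan ℝ s) : f x = 0 := by
  have hle : affineSpan ℝ s ≤ (AffineSubspace.mk' (0 : ℝ) ⊥).comap f := by
    rw [affineSpan_le]
    intro y hy
    simp [h y hy]
  simpa using hle hx

lemma ae_affineMap_ne_zero {f : Pt d →ᵃ[ℝ] ℝ} {x : Pt d} (hx : f x ≠ 0) :
    ∀ᵐ y : Pt d, f y ≠ 0 := by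
  have h : {y | ¬f y ≠ 0} = ((AffineSubspace.mk' (0 : ℝ) ⊥).comap f : Set (Pt d)) := by
    ext y; simp
  rw [ae_iff, h]
  refine Measure.addHaar_affineSubspace volume _ fun htop => hx ?_
  have : x ∈ (AffineSubspace.mk' (0 : ℝ) ⊥).comap f := by rw [htop]; trivial
  simpa using this

/-- Almost every line of a given direction avoids the intersections of two facets of a cell: those
that meet such an intersection form a family of one dimension less. -/
lemma ae_forall_line_avoids (K : Cell d) (e : Pt d) : ∀ᵐ y : Pt d, ∀ i j, i ≠ j → ∀ t : ℝ,
    ¬((bary K).coord i (y + t • e) = 0 ∧ (bary K).coord j (y + t • e) = 0) := by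
  rw [ae_all_iff]; intro i
  rw [ae_all_iff]; intro j
  rw [Filter.eventually_imp_distrib_left]; intro hij
  have hcoord : ∀ l y (t : ℝ), (bary K).coord l (y + t • e) =
      (bary K).coord l y + t * ((bary K).coord l).linear e := by
    intro l y t
    have := ((bary K).coord l).map_vadd y (t • e)
    rw [vadd_eq_add, add_comm (t • e) y] at this
    rw [this, map_smul, vadd_eq_add, smul_eq_mul]
    exact add_comm _ _
  set a := ((bary K).coord i).linear e
  set b := ((bary K).coord j).linear e
  by_cases hab : a = 0 ∧ b = 0
  · -- along the line both coordinates are constant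
    filter_upwards [ae_affineMap_ne_zero (f := (bary K).coord i) (x := bary K i) (by simp)] with y hy t ⟨h1, _⟩
    rw [hcoord] at h1
    change _ + t * a = 0 at h1
    rw [hab.1, mul_zero, add_zero] at h1
    exact hy h1
  · -- eliminate the parameter of the line from the two equations
    set f : Pt d →ᵃ[ℝ] ℝ := b • (bary K).coord i - a • (bary K).coord j
    have hf : ∀ y, f y = b * (bary K).coord i y - a * (bary K).coord j y := fun y => rfl
    have hne : ∃ x, f x ≠ 0 := by
      by_cases hb : b = 0
      · refine ⟨bary K j, ?_⟩
        have ha : a ≠ 0 := fun ha => hab ⟨ha, hb⟩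
        simp [hf, hb, ha]
      · refine ⟨bary K i, ?_⟩
        simp [hf, hb, (bary K).coord_apply_ne hij.symm]
    obtain ⟨x, hx⟩ := hne
    filter_upwards [ae_affineMap_ne_zero hx] with y hy t ⟨h1, h2⟩
    rw [hcoord] at h1 h2
    refine hy ?_
    rw [hf]
    linear_combination b * h1 - a * h2

variable [NeZero d] (M : Mesh d)

/-! ### Conforming meshes -/

/-- In a conforming mesh the vertices of `K` that carry a point of `K ∩ L` belong to `L`. -/
lemma point_mem_range_of_coord_pos {K L : Cell d} (hK : K ∈ M.cells) (hL : L ∈ M.cells)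
    (hne : K ≠ L) {z : Pt d} (hzK : z ∈ body K) (hzL : z ∈ body L) {j : Fin (d + 1)}
    (hj : 0 < (bary K).coord j z) : K.points j ∈ Set.range L.points := by
  by_contra hcon
  have hz : z ∈ convexHull ℝ (Set.range K.points ∩ Set.range L.points) := by
    rw [← M.conforming K hK L hL hne]; exact ⟨hzK, hzL⟩
  have hsub : Set.range K.points ∩ Set.range L.points ⊆ K.points '' {j}ᶜ := by
    rintro _ ⟨⟨l, rfl⟩, hl⟩
    refine ⟨l, ?_, rfl⟩
    rintro rfl
    exact hcon hl
  exact hj.ne' (coord_eq_zero_of_mem_facet K (convexHull_mono hsub hz))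

/-- Two cells that meet in a point in the relative interior of a facet share this facet. -/
lemma exists_facet_eq {K L : Cell d} (hK : K ∈ M.cells) (hL : L ∈ M.cells) (hne : K ≠ L)
    {z : Pt d} (hzK : z ∈ body K) (hzL : z ∈ body L)
    (hz : ∀ i j, i ≠ j → ¬((bary K).coord i z = 0 ∧ (bary K).coord j z = 0)) :
    ∃ i j, facet L j = facet K i := by
  have hpos : ∀ j, (bary K).coord j z ≠ 0 → K.points j ∈ Set.range L.points := fun j hj =>
    point_mem_range_of_coord_pos M hK hL hne hzK hzL
      (lt_of_le_of_ne ((mem_body_iff K z).1 hzK j) hj.symm)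
  choose! g hg using hpos
  by_cases h0 : ∃ i, (bary K).coord i z = 0
  · obtain ⟨i, hi⟩ := h0
    have hmem : ∀ j, j ≠ i → L.points (g j) = K.points j := fun j hj =>
      hg j fun h => hz j i hj ⟨h, hi⟩
    have hinj : Set.InjOn g (({i}ᶜ : Finset (Fin (d + 1))) : Set (Fin (d + 1))) := by
      intro a ha b hb hab
      have ha : a ≠ i := by simpa using ha
      have hb : b ≠ i := by simpa using hb
      exact K.independent.injective (by rw [← hmem a ha, ← hmem b hb, hab])
    have hcard : (Finset.image g {i}ᶜ)ᶜ.card = 1 := by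
      rw [Finset.card_compl, Finset.card_image_of_injOn hinj, Finset.card_compl,
        Finset.card_singleton, Fintype.card_fin]
      omega
    obtain ⟨j, hj⟩ := Finset.card_eq_one.1 hcard
    have himg : (g '' {i}ᶜ : Set (Fin (d + 1))) = {j}ᶜ := by
      have h1 := congrArg (fun s : Finset (Fin (d + 1)) => ((sᶜ : Finset _) : Set (Fin (d + 1)))) hj
      simpa using h1
    refine ⟨i, j, ?_⟩
    rw [facet, facet, ← himg, Set.image_image]
    congr 1
    exact Set.image_congr fun a ha => hmem a ha
  · push Not at h0
    exfalso
    have hginj : Function.Injective g := fun a b hab =>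
      K.independent.injective (by rw [← hg a (h0 a), ← hg b (h0 b), hab])
    have hgsurj : Function.Surjective g := Finite.surjective_of_injective hginj
    refine M.vertices_ne K hK L hL hne (Set.Subset.antisymm ?_ ?_)
    · rintro _ ⟨a, rfl⟩; exact ⟨g a, hg a (h0 a)⟩
    · rintro _ ⟨b, rfl⟩
      obtain ⟨a, rfl⟩ := hgsurj b
      exact ⟨a, (hg a (h0 a)).symm⟩

lemma faceNormal_eq_or {K : Cell d} (hK : K ∈ M.cells) (i : Fin (d + 1)) :
    M.faceNormal (facet K i) = normal K i ∨ M.faceNormal (facet K i) = -normal K i := by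
  obtain ⟨L, -, j, hLj, hn⟩ := M.faceNormal_spec K hK i
  rw [hn]
  exact normal_eq_or_eq_neg hLj

/-! ### The energy seminorm is a norm -/

variable {M}

/-- If the normal derivative of `v_K` matches the face unknown on the faces of `K`, then the face
unknown is the derivative of `v_K` in the direction of the fixed normal of the face. -/
lemma faceFun_eq_dn {v : M.CellFun × M.FaceFun} {K : M.cells}
    (hv : (M.localize v K).2 = dnBd K.1 (v.1 K)) {F : M.faces} {i : Fin (d + 1)}
    (hF : facet K.1 i = F) (x : F.1) : v.2 F x = dn (M.faceNormal F.1) (v.1 K) x := by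
  obtain ⟨F, hFm⟩ := F
  obtain rfl : facet K.1 i = F := hF
  have h := congrFun (congrFun hv i) x
  change inner ℝ (M.faceNormal (facet K.1 i)) (normal K.1 i) * v.2 ⟨facet K.1 i, _⟩ x =
    dn (normal K.1 i) (v.1 K) x at h
  change _ = dn (M.faceNormal (facet K.1 i)) (v.1 K) x
  have hself : inner ℝ (normal K.1 i) (normal K.1 i) = 1 := by
    rw [real_inner_self_eq_norm_sq, norm_normal, one_pow]
  rcases faceNormal_eq_or M K.2 i with hn | hn
  · rw [hn, hself, one_mul] at h
    rw [hn, h]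
  · rw [hn, inner_neg_left, hself] at h
    rw [hn, dn_neg_left, ← h]
    ring

/-- Affine functions on two cells with a common facet coincide if their values and their normal
derivatives on this facet do. -/
lemma eq_of_shared_facet {v : M.CellFun × M.FaceFun}
    (haff : ∀ K, v.1 K ∈ polySpace d 1)
    (hcont : ∀ K L : M.cells, ∀ x ∈ body K.1 ∩ body L.1,
      polyVal (v.1 K) x = polyVal (v.1 L) x)
    (hn : ∀ K, (M.localize v K).2 = dnBd K.1 (v.1 K)) {K L : M.cells} {i j : Fin (d + 1)}
    (h : facet L.1 j = facet K.1 i) : v.1 K = v.1 L := by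
  rw [← sub_eq_zero]
  set q := v.1 K - v.1 L
  have hq : q ∈ polySpace d 1 := Submodule.sub_mem _ (haff K) (haff L)
  have hface : ∀ x ∈ facet K.1 i, polyVal q x = 0 := fun x hx => by
    rw [polyVal_sub, sub_eq_zero]
    exact hcont K L x ⟨facet_subset_body _ _ hx, facet_subset_body L.1 j (h ▸ hx)⟩
  have hvert : ∀ l, l ≠ i → affMap hq (K.1.points l) = 0 := fun l hl =>
    hface _ (subset_convexHull ℝ _ ⟨l, hl, rfl⟩)
  have hfoot : affMap hq (K.1.altitudeFoot i) = 0 :=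
    affineMap_eq_zero_of_mem_affineSpan (by rintro _ ⟨l, hl, rfl⟩; exact hvert l hl)
      (K.1.altitudeFoot_mem_affineSpan_image_compl i)
  have hdn : dn (K.1.altitudeFoot i - K.1.points i) q (K.1.points i) = 0 := by
    obtain ⟨x, hx⟩ : (facet K.1 i).Nonempty := by
      have : Nontrivial (Fin (d + 1)) := Fin.nontrivial_iff_two_le.2 (by
        have := NeZero.pos d; omega)
      obtain ⟨l, hl⟩ := exists_ne i
      exact ⟨_, subset_convexHull ℝ _ ⟨l, hl, rfl⟩⟩
    let F : M.faces := ⟨facet K.1 i, K.1, K.2, i, rfl⟩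
    have h1 := faceFun_eq_dn (hn K) (F := F) rfl ⟨x, hx⟩
    have h2 := faceFun_eq_dn (hn L) (F := F) h ⟨x, hx⟩
    have h3 : dn (M.faceNormal (facet K.1 i)) q x = 0 := by
      rw [dn_sub, sub_eq_zero]; exact h1.symm.trans h2
    have h4 : dn (normal K.1 i) q x = 0 := by
      rcases faceNormal_eq_or M K.2 i with hn | hn
      · rwa [hn] at h3
      · rwa [hn, dn_neg_left, neg_eq_zero] at h3
    rw [normal, dn_smul_left, dn_eq_of_mem_polySpace_one hq _ x (K.1.points i)] at h4
    exact (mul_eq_zero.1 h4).resolve_left (inv_ne_zero (K.1.height_pos i).ne')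
  have hpt : affMap hq (K.1.points i) = 0 := by
    have := polyVal_eq_add_dn hq (K.1.points i) (K.1.altitudeFoot i)
    rw [hdn, add_zero] at this
    exact this.symm.trans hfoot
  refine eq_zero_of_isOpen isOpen_univ Set.univ_nonempty fun x _ => ?_
  refine affineMap_eq_zero_of_mem_affineSpan (f := affMap hq) (s := Set.range K.1.points) ?_ ?_
  · rintro _ ⟨l, rfl⟩
    by_cases hl : l = i
    · rw [hl]; exact hpt
    · exact hvert l hl
  · rw [affineSpan_points]; trivial

/-- From a point of a cell, follow a line in general position to the last point of the cells on
which the affine function is the same. There it vanishes: a cell beyond this point would share a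
facet with the last cell and therefore carry the same affine function. -/
lemma exists_zero_on_ray {v : M.CellFun × M.FaceFun}
    (hshare : ∀ (K L : M.cells) i j, facet L.1 j = facet K.1 i → v.1 K = v.1 L)
    (hbd : ∀ K : M.cells, ∀ x ∈ body K.1 ∩ frontier M.domain, polyVal (v.1 K) x = 0)
    {K : M.cells} {y e : Pt d} (hy : y ∈ body K.1) (he : e ≠ 0)
    (hgen : ∀ L ∈ M.cells, ∀ i j, i ≠ j → ∀ t : ℝ,
      ¬((bary L).coord i (y + t • e) = 0 ∧ (bary L).coord j (y + t • e) = 0)) :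
    ∃ t : ℝ, 0 ≤ t ∧ polyVal (v.1 K) (y + t • e) = 0 := by
  set U : Set (Pt d) := ⋃ L ∈ {L : M.cells | v.1 L = v.1 K}, body L.1
  set Z : Set (Pt d) := ⋃ L ∈ {L : M.cells | v.1 L ≠ v.1 K}, body L.1
  have hU : IsCompact U := (Set.toFinite _).isCompact_biUnion fun L _ => isCompact_body L.1
  have hZ : IsClosed Z := ((Set.toFinite _).isCompact_biUnion fun L _ =>
    isCompact_body L.1).isClosed
  have hUZ : (⋃ L ∈ M.cells, body L) ⊆ U ∪ Z := by
    intro x hx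
    simp only [Set.mem_iUnion] at hx
    obtain ⟨L, hL, hx⟩ := hx
    by_cases h : v.1 ⟨L, hL⟩ = v.1 K
    · exact Or.inl (Set.mem_iUnion₂.2 ⟨⟨L, hL⟩, h, hx⟩)
    · exact Or.inr (Set.mem_iUnion₂.2 ⟨⟨L, hL⟩, h, hx⟩)
  have hline : Continuous fun t : ℝ => y + t • e := by fun_prop
  obtain ⟨t, ⟨ht0, htU⟩, htmax⟩ : ∃ t, IsGreatest {t : ℝ | 0 ≤ t ∧ y + t • e ∈ U} t := by
    refine IsCompact.exists_isGreatest ?_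
      ⟨0, le_rfl, by
        rw [zero_smul, add_zero]
        exact Set.mem_iUnion₂.2 ⟨K, rfl, hy⟩⟩
    refine Metric.isCompact_of_isClosed_isBounded ?_ ?_
    · exact isClosed_Ici.inter (hU.isClosed.preimage hline)
    · obtain ⟨R, hR⟩ := hU.isBounded.subset_closedBall y
      refine (Metric.isBounded_closedBall (x := (0 : ℝ)) (r := R / ‖e‖)).subset ?_
      rintro s ⟨-, hs⟩
      have := hR hs
      rw [mem_closedBall_iff_norm, add_sub_cancel_left, norm_smul] at this
      rw [mem_closedBall_zero_iff, le_div_iff₀ (norm_pos_iff.2 he)]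
      exact this
  refine ⟨t, ht0, ?_⟩
  set z := y + t • e
  obtain ⟨L, hL, hzL⟩ := Set.mem_iUnion₂.1 htU
  have hL : v.1 L = v.1 K := hL
  rw [← hL]
  by_cases hfr : z ∈ frontier M.domain
  · exact hbd L z ⟨hzL, hfr⟩
  exfalso
  have hzdom : z ∈ M.domain := by
    have hcl : z ∈ closure M.domain := by
      have h1 : z ∈ closure (interior (body L.1)) := by
        rw [(convex_body L.1).closure_interior_eq_closure_of_nonempty_interior
          (interior_body_nonempty L.1)]
        exact subset_closure hzL
      exact closure_mono (interior_mono (Set.subset_biUnion_of_mem (u := body) L.2)) h1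
    by_contra hnot
    exact hfr ⟨hcl, fun h => hnot (interior_subset h)⟩
  have hzZ : z ∈ Z := by
    by_contra hzZ
    have hopen : IsOpen ((fun t : ℝ => y + t • e) ⁻¹' (M.domain ∩ Zᶜ)) :=
      (isOpen_interior.inter hZ.isOpen_compl).preimage hline
    obtain ⟨ε, hε, hball⟩ := Metric.isOpen_iff.1 hopen t ⟨hzdom, hzZ⟩
    have hmem : t + ε / 2 ∈ Metric.ball t ε := by
      rw [Metric.mem_ball, Real.dist_eq, add_sub_cancel_left, abs_of_pos (by linarith)]
      linarith
    obtain ⟨h1, h2⟩ := hball hmem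
    have h3 := (hUZ (interior_subset h1)).resolve_right h2
    have := htmax ⟨by linarith, h3⟩
    linarith
  obtain ⟨L', hL', hzL'⟩ := Set.mem_iUnion₂.1 hzZ
  have hL' : v.1 L' ≠ v.1 K := hL'
  have hne : L.1 ≠ L'.1 := fun h => hL' (by rw [← hL, Subtype.ext h])
  obtain ⟨i, j, hij⟩ := exists_facet_eq M L.2 L'.2 hne hzL hzL'
    fun i j hij => hgen L.1 L.2 i j hij t
  exact hL' ((hshare L L' i j hij).symm.trans hL)

/-- Continuous piecewise affine functions with continuous normal derivatives across the faces that
vanish on `∂Ω` are zero. -/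
lemma cellFun_eq_zero {v : M.CellFun × M.FaceFun} (haff : ∀ K, v.1 K ∈ polySpace d 1)
    (hcont : ∀ K L : M.cells, ∀ x ∈ body K.1 ∩ body L.1,
      polyVal (v.1 K) x = polyVal (v.1 L) x)
    (hbd : ∀ K : M.cells, ∀ x ∈ body K.1 ∩ frontier M.domain, polyVal (v.1 K) x = 0)
    (hn : ∀ K, (M.localize v K).2 = dnBd K.1 (v.1 K)) : v.1 = 0 := by
  funext K
  by_contra hK
  obtain ⟨x, hxK, hx⟩ : ∃ x ∈ interior (body K.1), polyVal (v.1 K) x ≠ 0 := by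
    by_contra! h
    exact hK (eq_zero_of_isOpen isOpen_interior (interior_body_nonempty K.1) h)
  set e : Pt d := EuclideanSpace.single 0 1
  have he : e ≠ 0 := by simp [e]
  have hae : ∀ᵐ y : Pt d, ∀ L ∈ M.cells, ∀ i j, i ≠ j → ∀ t : ℝ,
      ¬((bary L).coord i (y + t • e) = 0 ∧ (bary L).coord j (y + t • e) = 0) :=
    (Filter.eventually_all_finset M.cells).2 fun L _ => ae_forall_line_avoids L e
  have hopen : IsOpen (interior (body K.1) ∩ {x | polyVal (v.1 K) x ≠ 0}) :=
    isOpen_interior.inter (isOpen_ne_fun (continuous_polyVal _) continuous_const)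
  obtain ⟨y, hgen, hyK, hy⟩ : ∃ y, (∀ L ∈ M.cells, ∀ i j, i ≠ j → ∀ t : ℝ,
      ¬((bary L).coord i (y + t • e) = 0 ∧ (bary L).coord j (y + t • e) = 0)) ∧
      y ∈ interior (body K.1) ∧ polyVal (v.1 K) y ≠ 0 := by
    obtain ⟨y, hy, hg⟩ := (Measure.dense_of_ae hae).inter_open_nonempty _ hopen ⟨x, hxK, hx⟩
    exact ⟨y, hg, hy.1, hy.2⟩
  have hshare : ∀ (K L : M.cells) i j, facet L.1 j = facet K.1 i → v.1 K = v.1 L :=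
    fun K L i j h => eq_of_shared_facet haff hcont hn h
  obtain ⟨t, ht, h1⟩ := exists_zero_on_ray hshare hbd (interior_subset hyK) he hgen
  obtain ⟨s, hs, h2⟩ := exists_zero_on_ray hshare hbd (interior_subset hyK)
    (neg_ne_zero.2 he) fun L hL i j hij t => by
      have := hgen L hL i j hij (-t)
      rwa [neg_smul, ← smul_neg] at this
  -- an affine function on a line that vanishes on both sides of a point vanishes there
  rw [polyVal_add_smul (haff K)] at h1 h2
  rw [dn_neg_left] at h2
  set b := dn e (v.1 K) y
  rcases eq_or_ne b 0 with hb | hb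
  · rw [hb, mul_zero, add_zero] at h1
    exact hy h1
  · have h3 : (t + s) * b = 0 := by linarith
    have h4 : t + s = 0 := (mul_eq_zero.1 h3).resolve_right hb
    have h5 : t = 0 := by linarith
    rw [h5, zero_mul, add_zero] at h1
    exact hy h1

lemma localize_mem {k : ℕ} {v : M.CellFun × M.FaceFun} (h1 : ∀ K, v.1 K ∈ polySpace d (k + 2))
    (h2 : v.2 ∈ M.faceSpace k) (K : M.cells) : M.localize v K ∈ localSpace k K.1 :=
  ⟨h1 K, fun i _ => Submodule.smul_mem (facePoly k (facet K.1 i)) _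
    (h2 ⟨facet K.1 i, K.1, K.2, i, rfl⟩ trivial)⟩

lemma localEnergy_nonneg {k : ℕ} {K : Cell d} {v : LocalPair K} (hv : v ∈ localSpace k K) :
    0 ≤ localEnergy K v := by
  rw [localEnergy_eq hv]
  exact add_nonneg (hessForm_self_nonneg K _)
    (mul_nonneg (inv_nonneg.2 (diamCell_pos K).le) (bdForm_self_nonneg K _))

lemma of_localEnergy_eq_zero {k : ℕ} {K : Cell d} {v : LocalPair K} (hv : v ∈ localSpace k K)
    (h : localEnergy K v = 0) : v.1 ∈ polySpace d 1 ∧ v.2 = dnBd K v.1 := by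
  rw [localEnergy_eq hv] at h
  have hh := inv_pos.2 (diamCell_pos K)
  have h1 := hessForm_self_nonneg K v.1
  have h2 := mul_nonneg hh.le (bdForm_self_nonneg K (jump hv))
  refine ⟨mem_polySpace_one_of_hessForm_self (K := K) (by linarith), ?_⟩
  have h3 : (diamCell K)⁻¹ * bdForm K (jump hv) (jump hv) = 0 := by linarith
  have h4 := eq_zero_of_bdForm_self ((mul_eq_zero.1 h3).resolve_left hh.ne')
  exact sub_eq_zero.1 (congrArg Subtype.val h4)

variable {k : ℕ} {W : Submodule ℝ M.FaceFun}

lemma toFun_localize_mem (hW : W ≤ M.faceSpace k) (v : M.HHOSpace k W) (K : M.cells) :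
    M.localize (M.toFun v) K ∈ localSpace k K.1 :=
  localize_mem v.1.2.1 (hW v.2.2) K

lemma energy_nonneg (hW : W ≤ M.faceSpace k) (v : M.HHOSpace k W) : 0 ≤ M.energy (M.toFun v) :=
  Finset.sum_nonneg fun K _ => localEnergy_nonneg (toFun_localize_mem hW v K)

lemma eq_zero_of_energy_eq_zero (hW : W ≤ M.faceSpace k) {v : M.HHOSpace k W}
    (h : M.energy (M.toFun v) = 0) : v = 0 := by
  have hloc := (Finset.sum_eq_zero_iff_of_nonneg fun K _ =>
    localEnergy_nonneg (toFun_localize_mem hW v K)).1 h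
  have hz := fun K => of_localEnergy_eq_zero (toFun_localize_mem hW v K) (hloc K (Finset.mem_univ _))
  have h1 : (M.toFun v).1 = 0 := cellFun_eq_zero (v := M.toFun v) (fun K => (hz K).1) v.1.2.2.1
    v.1.2.2.2 fun K => (hz K).2
  refine Prod.ext (Subtype.ext h1) (Subtype.ext ?_)
  funext F x
  obtain ⟨K, hK, i, hF⟩ := F.2
  have := faceFun_eq_dn (v := M.toFun v) (K := ⟨K, hK⟩) (hz ⟨K, hK⟩).2 hF.symm x
  rw [h1] at this
  exact this.trans (by simp [dn])

/-! ### The discrete problem -/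

/-- The jump `γ_{∂K} - ∂_n v_K` as a linear map on the local space. -/
def jumpLin (k : ℕ) (K : Cell d) : localSpace k K →ₗ[ℝ] contBd K where
  toFun v := jump v.2
  map_add' v w := by
    ext i x
    change v.1.2 i x + w.1.2 i x - dn (normal K i) (v.1.1 + w.1.1) x =
      (v.1.2 i x - dn (normal K i) v.1.1 x) + (w.1.2 i x - dn (normal K i) w.1.1 x)
    rw [dn_add]
    ring
  map_smul' c v := by
    ext i x
    change c * v.1.2 i x - dn (normal K i) (c • v.1.1) x =
      c * (v.1.2 i x - dn (normal K i) v.1.1 x)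
    rw [dn_smul]
    ring

/-- The reconstruction as a linear map on the local space. -/
def reconLin (k : ℕ) (K : Cell d) : localSpace k K →ₗ[ℝ] Poly d where
  toFun v := recon k K v
  map_add' v w := by
    have h1 := (isReconstruction_iff v.2 _).1 (recon_spec v.2)
    have h2 := (isReconstruction_iff w.2 _).1 (recon_spec w.2)
    refine (existsUnique_isReconstruction (v + w).2).unique (recon_spec (v + w).2) ?_
    rw [isReconstruction_iff (v + w).2]
    have hj : jump (v + w).2 = jump v.2 + jump w.2 := (jumpLin k K).map_add v w
    have hs : recon k K v + recon k K w - (v + w : localSpace k K).1.1 =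
        (recon k K v - v.1.1) + (recon k K w - w.1.1) := by
      rw [Submodule.coe_add, Prod.fst_add]; abel
    rw [hj, hs]
    refine ⟨Submodule.add_mem _ h1.1 h2.1, fun u hu => ?_⟩
    rw [map_add, map_add, LinearMap.add_apply, LinearMap.add_apply, h1.2 u hu, h2.2 u hu]
  map_smul' c v := by
    have h1 := (isReconstruction_iff v.2 _).1 (recon_spec v.2)
    refine (existsUnique_isReconstruction (c • v).2).unique (recon_spec (c • v).2) ?_
    rw [isReconstruction_iff (c • v).2]
    have hj : jump (c • v).2 = c • jump v.2 := (jumpLin k K).map_smul c v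
    have hs : c • recon k K v - (c • v : localSpace k K).1.1 = c • (recon k K v - v.1.1) := by
      rw [Submodule.coe_smul, Prod.smul_fst, smul_sub]
    rw [hj, RingHom.id_apply, hs]
    refine ⟨Submodule.smul_mem _ c h1.1, fun u hu => ?_⟩
    rw [map_smul, map_smul, LinearMap.smul_apply, LinearMap.smul_apply, h1.2 u hu]

/-- The bilinear form `(Π^k_{∂K} φ, ψ)_{∂K}`. -/
def projForm (k : ℕ) (K : Cell d) : LinearMap.BilinForm ℝ (contBd K) :=
  have hcomm : ∀ φ ψ : contBd K, bdForm K (bdProjC k K φ) ψ = bdForm K (bdProjC k K ψ) φ :=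
    fun φ ψ => by
      rw [bdForm_bdProjC_self, bdForm_bdProjC_self k K ψ]
      simpa using (bdForm_isSymm K).eq (bdProjC k K φ) (bdProjC k K ψ)
  LinearMap.mk₂ ℝ (fun φ ψ => bdForm K (bdProjC k K φ) ψ)
    (fun φ φ' ψ => by rw [hcomm, map_add, hcomm ψ, hcomm ψ])
    (fun c φ ψ => by rw [hcomm, map_smul, hcomm ψ])
    (fun φ ψ ψ' => map_add _ _ _)
    (fun c φ ψ => map_smul _ _ _)

/-- The form `a_K` as a bilinear form on the local space. -/
def localBilin (k : ℕ) (K : Cell d) : LinearMap.BilinForm ℝ (localSpace k K) :=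
  (hessForm K).compl₁₂ (reconLin k K) (reconLin k K) +
    (diamCell K)⁻¹ • (projForm k K).compl₁₂ (jumpLin k K) (jumpLin k K)

lemma localBilin_apply (K : Cell d) (v w : localSpace k K) :
    localBilin k K v w = localForm k K v w := by
  rw [localForm, ← hessForm_apply]; rfl

/-- The restriction of a global unknown to a cell as a linear map. -/
def localizeLin (hW : W ≤ M.faceSpace k) (K : M.cells) :
    M.HHOSpace k W →ₗ[ℝ] localSpace k K.1 where
  toFun v := ⟨M.localize (M.toFun v) K, toFun_localize_mem hW v K⟩
  map_add' _ _ := Subtype.ext <| Prod.ext rfl <| funext fun _ => funext fun _ => mul_add _ _ _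
  map_smul' _ _ := Subtype.ext <| Prod.ext rfl <| funext fun _ => funext fun _ =>
    mul_left_comm _ _ _

/-- The form `a_h` as a bilinear form on the global space. -/
def globalBilin (hW : W ≤ M.faceSpace k) : LinearMap.BilinForm ℝ (M.HHOSpace k W) :=
  ∑ K, (localBilin k K.1).compl₁₂ (localizeLin hW K) (localizeLin hW K)

lemma globalBilin_apply (hW : W ≤ M.faceSpace k) (v w : M.HHOSpace k W) :
    globalBilin hW v w = M.form k (M.toFun v) (M.toFun w) := by
  rw [globalBilin, LinearMap.sum_apply, LinearMap.sum_apply]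
  exact Finset.sum_congr rfl fun K _ => localBilin_apply _ _ _

lemma finite_faces : Finite M.faces := by
  refine Set.Finite.to_subtype ((Set.finite_range fun p : M.cells × Fin (d + 1) =>
    facet p.1.1 p.2).subset ?_)
  rintro F ⟨K, hK, i, rfl⟩
  exact ⟨(⟨K, hK⟩, i), rfl⟩

lemma finiteDimensional_HHOSpace (hW : W ≤ M.faceSpace k) :
    FiniteDimensional ℝ (M.HHOSpace k W) := by
  have := finite_faces (M := M)
  let f : M.HHOSpace k W →ₗ[ℝ]
      ((_ : M.cells) → polySpace d (k + 2)) × ((F : M.faces) → facePoly k F.1) :=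
    { toFun := fun v => (fun K => ⟨v.1.1 K, v.1.2.1 K⟩, fun F => ⟨v.2.1 F, hW v.2.2 F trivial⟩)
      map_add' := fun _ _ => rfl
      map_smul' := fun _ _ => rfl }
  refine FiniteDimensional.of_injective f fun v w h => ?_
  refine Prod.ext (Subtype.ext (funext fun K => ?_)) (Subtype.ext (funext fun F => ?_))
  · exact congrArg Subtype.val (congrFun (congrArg Prod.fst h) K)
  · exact congrArg Subtype.val (congrFun (congrArg Prod.snd h) F)

end Global

end C0HHO

end

theorem lemma3p1 (d : ℕ) [NeZero d] (hd : d = 2 ∨ d = 3) (k : ℕ) (σ : ℝ) :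
    ∃ α : ℝ, 0 < α ∧ ∀ M : C0HHO.Mesh d, M.ShapeRegular σ →
      -- the reconstruction is well defined; local stability and boundedness
      (∀ K ∈ M.cells, ∀ v ∈ C0HHO.localSpace k K,
        (∃! r, C0HHO.IsReconstruction k K v r) ∧
        α * C0HHO.localEnergy K v ≤
          C0HHO.hessInner K (C0HHO.recon k K v) (C0HHO.recon k K v) + C0HHO.stab k K v v ∧
        C0HHO.hessInner K (C0HHO.recon k K v) (C0HHO.recon k K v) + C0HHO.stab k K v v ≤
          α⁻¹ * C0HHO.localEnergy K v) ∧
      -- the discrete problems with clamped and with simply supported boundary conditions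
      (∀ W : Submodule ℝ M.FaceFun, W = M.faceSpace0 k ∨ W = M.faceSpace k →
        -- the energy seminorm is a norm, and the bilinear form is coercive
        (∀ v : M.HHOSpace k W, M.energyNorm (M.toFun v) = 0 → v = 0) ∧
        (∀ v : M.HHOSpace k W,
          α * M.energyNorm (M.toFun v) ^ 2 ≤ M.form k (M.toFun v) (M.toFun v)) ∧
        -- well-posedness: existence, uniqueness, continuous dependence on the data
        ∀ ℓ : M.cellSpace0 (k + 2) →ₗ[ℝ] ℝ,
          (∃! u : M.HHOSpace k W, M.IsDiscreteSolution k W ℓ u) ∧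
          ∀ u : M.HHOSpace k W, M.IsDiscreteSolution k W ℓ u → ∀ C : ℝ, 0 ≤ C →
            (∀ w : M.HHOSpace k W, |ℓ w.1| ≤ C * M.energyNorm (M.toFun w)) →
            M.energyNorm (M.toFun u) ≤ α⁻¹ * C) := by
  obtain ⟨α, hα, hloc⟩ := C0HHO.exists_local_stability d k σ
  refine ⟨α, hα, fun M hM => ⟨fun K hK v hv =>
    ⟨C0HHO.existsUnique_isReconstruction hv, hloc K (hM K hK) v hv⟩, fun W hW => ?_⟩⟩
  have hle : W ≤ M.faceSpace k := by
    rcases hW with rfl | rfl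
    · exact inf_le_left
    · exact le_rfl
  have hsq : ∀ v : M.HHOSpace k W, M.energyNorm (M.toFun v) ^ 2 = M.energy (M.toFun v) :=
    fun v => Real.sq_sqrt (C0HHO.energy_nonneg hle v)
  have hdef : ∀ v : M.HHOSpace k W, M.energyNorm (M.toFun v) = 0 → v = 0 := fun v hv =>
    C0HHO.eq_zero_of_energy_eq_zero hle (by rw [← hsq, hv, zero_pow two_ne_zero])
  have hcoer : ∀ v : M.HHOSpace k W,
      α * M.energyNorm (M.toFun v) ^ 2 ≤ M.form k (M.toFun v) (M.toFun v) := fun v => by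
    rw [hsq, C0HHO.Mesh.energy, C0HHO.Mesh.form, Finset.mul_sum]
    exact Finset.sum_le_sum fun K _ =>
      (hloc K.1 (hM K.1 K.2) _ (C0HHO.toFun_localize_mem hle v K)).1
  refine ⟨hdef, hcoer, fun ℓ => ⟨?_, fun u hu C hC hℓ => ?_⟩⟩
  · have := C0HHO.finiteDimensional_HHOSpace hle
    have huniq := C0HHO.existsUnique_riesz (C0HHO.globalBilin hle) (fun v hv => by
      rw [C0HHO.globalBilin_apply] at hv
      have h1 := hcoer v
      rw [hv] at h1
      exact hdef v (pow_eq_zero_iff two_ne_zero |>.1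
        (le_antisymm (nonpos_of_mul_nonpos_right h1 hα) (sq_nonneg _))))
      (ℓ ∘ₗ LinearMap.fst ℝ (M.cellSpace0 (k + 2)) W)
    simpa only [C0HHO.globalBilin_apply] using! huniq
  · have h1 := hcoer u
    rw [hu u] at h1
    have h2 := h1.trans ((le_abs_self _).trans (hℓ u))
    rw [inv_mul_eq_div, le_div_iff₀ hα]
    have hnn : 0 ≤ M.energyNorm (M.toFun u) := Real.sqrt_nonneg _
    rcases hnn.eq_or_lt with h0 | hpos
    · rw [← h0, zero_mul]; exact hC
    · refine le_of_mul_le_mul_right ?_ hpos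
      calc M.energyNorm (M.toFun u) * α * M.energyNorm (M.toFun u)
          = α * M.energyNorm (M.toFun u) ^ 2 := by ring
        _ ≤ _ := h2
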